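/- **Conventions.** A vocabulary $\tau$ is a finite set of relation symbols with arities; a $\tau$-structure $A$ has a non-empty finite universe $V(A)$ and a relation $R(A)\subseteq V(A)^{\operatorname{ar}(R)}$ for each $R\in\tau$. Its number sort is $N(A)=\{0,\dots,|V(A)|\}$. Variables are structure variables (ranging over $V(A)$) or number variables (ranging over $N(A)$). For a tuple $\bar u=(u_1,\dots,u_k)$ of variables let $A^{\bar u}$ be the product of the corresponding ranges; two tuples are compatible if they have the same length and the same sorts of components. For $\bar n=(n_1,\dots,n_k)\in N(A)^k$ put $\langle\bar n\rangle_A=\sum_{i=1}^k n_i(|V(A)|+1)^{i-1}$. For an assignment $\alpha$, $\varphi[A,\alpha;\bar u]$ denotes the set of $\bar a\in A^{\bar u}$ with $(A,\alpha[\bar a/\bar u])\models\varphi$. Tuples of variables bound by an operator consist of pairwise distinct variables. **The logic.** The $\mathrm{LREC}_=[\tau]$-formulae are built from atoms $R(x_1,\dots,x_k)$ and $x=y$ (structure variables), $p=q$ and $p\le q$ (number variables), by Boolean connectives, quantifiers over both sorts, and the following two rules. * $\#\bar u\,\psi=\bar p$ (with $\bar p$ a tuple of number variables) holds in $(A,\alpha)$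 iff $|\psi[A,\alpha;\bar u]|=\langle\alpha(\bar p)\rangle_A$. * $[\mathsf{lrec}_{\bar u,\bar v,\bar p}\ \varphi_=,\varphi_E,\varphi_C](\bar w,\bar r)$, where $\bar u,\bar v,\bar w$ are compatible and $\bar p,\bar r$ are non-empty tuples of number variables; $\bar u,\bar v$ are bound in $\varphi_=,\varphi_E$ and $\bar u,\bar p$ in $\varphi_C$. Let $\sim$ be the reflexive, symmetric, transitive closure of $\varphi_=[A,\alpha;\bar u,\bar v]$ on $A^{\bar u}$, let $\mathtt V=A^{\bar u}/_\sim$, let $\mathtt E=\{(\bar a/_\sim,\bar b/_\sim)\mid(\bar a,\bar b)\in\varphi_E[A,\alpha;\bar u,\bar v]\}$, and let $\mathtt C(c)=\{\langle\bar n\rangle_A\mid \bar n\in\varphi_C[A,\alpha[\bar a/\bar u];\bar p]\text{ for some }\bar a\in c\}$ for $c\in\mathtt V$. Define $X\subseteq\mathtt V\times\mathbb N$ recursively by: $(c,l)\in X$ iff $l>0$ and the number of $d$ with $(c,d)\in\mathtt E$ and $\bigl(d,\lfloor (l-1)/|\{c'\mid(c',d)\in\mathtt E\}|\rfloor\bigr)\in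 X$ belongs to $\mathtt C(c)$. The formula holds in $(A,\alpha)$ iff $\bigl(\alpha(\bar w)/_\sim,\langle\alpha(\bar r)\rangle_A\bigr)\in X$. **Transductions.** Let $\tau_1,\tau_2$ be vocabularies and $\ell\ge 1$. An $\ell$-ary $\mathrm{LREC}_=[\tau_1,\tau_2]$-transduction is a tuple $\Theta=\bigl(\theta_V(\bar u),\theta_\approx(\bar u,\bar v),(\theta_R(\bar u_{R,1},\dots,\bar u_{R,\operatorname{ar}(R)}))_{R\in\tau_2}\bigr)$ of $\mathrm{LREC}_=[\tau_1]$-formulae, with free variables among those displayed, where $\bar u,\bar v$ and all $\bar u_{R,i}$ are compatible $\ell$-tuples of variables. For a $\tau_1$-structure $A$ let $\approx$ be the equivalence relation on $A^{\bar u}$ generated by $\theta_\approx[A;\bar u,\bar v]$. If $\theta_V[A;\bar u]\neq\emptyset$ (in this case $\Theta[A]$ is said to be defined), $\Theta[A]$ is the $\tau_2$-structure with universe $V(\Theta[A])=\{\bar a/_\approx\mid\bar a\in\theta_V[A;\bar u]\}$ and relations $$R(\Theta[A])=\{(\bar a_1/_\approx,\dots,\bar a_{\operatorname{ar}(R)}/_\approx)\mid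 \bar a_1,\dots,\bar a_{\operatorname{ar}(R)}\in\theta_V[A;\bar u],\ A\models\theta_R[\bar a_1,\dots,\bar a_{\operatorname{ar}(R)}]\}.$$ **Lemma.** Let $\Theta$ be an $\ell$-ary $\mathrm{LREC}_=[\tau_1,\tau_2]$-transduction, and let $\varphi(x_1,\dots,x_\kappa,p_1,\dots,p_\lambda)$ be an $\mathrm{LREC}_=[\tau_2]$-formula with structure variables $x_i$ and number variables $p_j$ (and no other free variables). Then there is an $\mathrm{LREC}_=[\tau_1]$-formula $\varphi^{-\Theta}(\bar u_1,\dots,\bar u_\kappa,\bar q_1,\dots,\bar q_\lambda)$, where $\bar u_1,\dots,\bar u_\kappa$ are compatible with $\bar u$ and $\bar q_1,\dots,\bar q_\lambda$ are $\ell$-tuples of number variables, such that for all $\tau_1$-structures $A$ for which $\Theta[A]$ is defined, all $\bar a_1,\dots,\bar a_\kappa\in A^{\bar u}$ and all $\bar n_1,\dots,\bar n_\lambda\in N(A)^\ell$, we have $A\models\varphi^{-\Theta}[\bar a_1,\dots,\bar a_\kappa,\bar n_1,\dots,\bar n_\lambda]$ if and only if * $\bar a_1/_\approx,\dots,\bar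 a_\kappa/_\approx\in V(\Theta[A])$, * $\langle\bar n_1\rangle_A,\dots,\langle\bar n_\lambda\rangle_A\in N(\Theta[A])$, and * $\Theta[A]\models\varphi\bigl[\bar a_1/_\approx,\dots,\bar a_\kappa/_\approx,\langle\bar n_1\rangle_A,\dots,\langle\bar n_\lambda\rangle_A\bigr]$. -/

import Mathlib

universe u v u' v' w

namespace LREC

/-! Vocabularies are finite relational first-order languages of Mathlib, and structures over them
are Mathlib's structures on finite nonempty types.  Everything is two-sorted: structure variables
range over the universe, number variables range over the number sort. -/

/-- The number sort `N(A) = {0, ..., |A|}` of a finite structure with universe `A`. -/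
abbrev Num (A : Type w) : Type := Fin (Nat.card A + 1)

/-- The number `⟨n⟩_A = ∑ i, n_i * (|A| + 1) ^ i` (least significant digit first) coded by a tuple
over the number sort of `A`. -/
noncomputable def num {A : Type w} {k : ℕ} (n : Fin k → Num A) : ℕ :=
  ∑ i : Fin k, (n i : ℕ) * (Nat.card A + 1) ^ (i : ℕ)

/-- The set `A^u` of possible values of a tuple `u` consisting of `s` structure variables and `t`
number variables.  Two tuples of variables are compatible when they have the same `s` and `t`
(with the structure variables listed before the number variables). -/
abbrev Tup (A : Type w) (s t : ℕ) : Type w := (Fin s → A) × (Fin t → Num A)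

/-- `Formula τ X P` is the type of `LREC₌[τ]`-formulae whose free structure variables are among
`X` and whose free number variables are among `P`.  An operator binding a tuple of pairwise
distinct variables (`s` structure and `t` number variables) is applied to a formula over the
extended sets of variables `X ⊕ Fin s` and `P ⊕ Fin t`. -/
inductive Formula (τ : FirstOrder.Language.{u, v}) : Type → Type → Type (max 1 v)
  /-- the atom `R(x₁, ..., xₙ)` -/
  | rel {X P : Type} {n : ℕ} (R : τ.Relations n) (x : Fin n → X) : Formula τ X P
  /-- equality of structure variables -/
  | eqS {X P : Type} (x y : X) : Formula τ X P
  /-- equality of number variables -/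
  | eqN {X P : Type} (p q : P) : Formula τ X P
  /-- the order on numbers -/
  | leN {X P : Type} (p q : P) : Formula τ X P
  | not {X P : Type} (φ : Formula τ X P) : Formula τ X P
  | and {X P : Type} (φ ψ : Formula τ X P) : Formula τ X P
  | or {X P : Type} (φ ψ : Formula τ X P) : Formula τ X P
  | imp {X P : Type} (φ ψ : Formula τ X P) : Formula τ X P
  | iff {X P : Type} (φ ψ : Formula τ X P) : Formula τ X P
  /-- quantifiers over a structure variable -/
  | allS {X P : Type} (φ : Formula τ (X ⊕ Fin 1) P) : Formula τ X P
  | exS {X P : Type} (φ : Formula τ (X ⊕ Fin 1) P) : Formula τ X P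
  /-- quantifiers over a number variable -/
  | allN {X P : Type} (φ : Formula τ X (P ⊕ Fin 1)) : Formula τ X P
  | exN {X P : Type} (φ : Formula τ X (P ⊕ Fin 1)) : Formula τ X P
  /-- the counting formula `#u ψ = p` -/
  | count {X P : Type} (s t k : ℕ) (ψ : Formula τ (X ⊕ Fin s) (P ⊕ Fin t)) (p : Fin k → P) :
      Formula τ X P
  /-- the recursion formula `[lrec_{u,v,p} φ₌, φ_E, φ_C](w, r)`; the bound tuples `u`, `v` and the
  tuple `w = (wS, wN)` are compatible with `s` structure and `t` number variables, and the number
  tuples `p` (bound in `φ_C`) and `r` are nonempty, of lengths `k + 1` and `m + 1` -/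
  | lrec {X P : Type} (s t k m : ℕ)
      (φeq φE : Formula τ (X ⊕ (Fin s ⊕ Fin s)) (P ⊕ (Fin t ⊕ Fin t)))
      (φC : Formula τ (X ⊕ Fin s) (P ⊕ (Fin t ⊕ Fin (k + 1))))
      (wS : Fin s → X) (wN : Fin t → P) (r : Fin (m + 1) → P) : Formula τ X P

/-- `LRecX E C l a` says that `(a, l)` belongs to the recursively defined relation `X` of the graph
with edge relation `E` and labels `C`, see `lRecX_iff`. -/
def LRecX {V : Type w} (E : V → V → Prop) (C : V → Set ℕ) : ℕ → V → Prop
  | 0, _ => False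
  | l + 1, a => Nat.card {b : V // E a b ∧ LRecX E C (l / Nat.card {c : V // E c b}) b} ∈ C a
termination_by l => l
decreasing_by exact Nat.lt_succ_of_le (Nat.div_le_self _ _)

/-- The defining equivalence of `X`: `(a, l) ∈ X` iff `l > 0` and the number of out-neighbours `b`
of `a` with `(b, ⌊(l - 1) / indegree b⌋) ∈ X` belongs to `C a`. -/
theorem lRecX_iff {V : Type w} (E : V → V → Prop) (C : V → Set ℕ) (l : ℕ) (a : V) :
    LRecX E C l a ↔ 0 < l ∧
      Nat.card {b : V // E a b ∧ LRecX E C ((l - 1) / Nat.card {c : V // E c b}) b} ∈ C a := by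
  cases l with
  | zero => simp [LRecX]
  | succ l => rw [LRecX]; simp

/-- The edge relation induced by `E₀` on the quotient by `S`. -/
def quotEdge {V₀ : Type w} (S : Setoid V₀) (E₀ : V₀ → V₀ → Prop) (c d : Quotient S) : Prop :=
  ∃ a b : V₀, Quotient.mk S a = c ∧ Quotient.mk S b = d ∧ E₀ a b

/-- The labels induced by `C₀` on the quotient by `S`. -/
def quotLabel {V₀ : Type w} (S : Setoid V₀) (C₀ : V₀ → Set ℕ) (c : Quotient S) : Set ℕ :=
  {i | ∃ a : V₀, Quotient.mk S a = c ∧ i ∈ C₀ a}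

/-- `φ.Realize A x p`: the formula `φ` holds in the structure `A` under the assignment sending the
structure variables to `x` and the number variables to `p`.  The relation `∼` in the
recursion formula is the equivalence relation generated by `φ₌` on `A^u`. -/
def Formula.Realize {τ : FirstOrder.Language.{u, v}} (A : Type w) [τ.Structure A] :
    {X P : Type} → Formula τ X P → (X → A) → (P → Num A) → Prop
  | _, _, .rel R x, α, _ => FirstOrder.Language.Structure.RelMap R (fun i => α (x i))
  | _, _, .eqS x y, α, _ => α x = α y
  | _, _, .eqN p q, _, β => β p = β q
  | _, _, .leN p q, _, β => β p ≤ β q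
  | _, _, .not φ, α, β => ¬ φ.Realize A α β
  | _, _, .and φ ψ, α, β => φ.Realize A α β ∧ ψ.Realize A α β
  | _, _, .or φ ψ, α, β => φ.Realize A α β ∨ ψ.Realize A α β
  | _, _, .imp φ ψ, α, β => φ.Realize A α β → ψ.Realize A α β
  | _, _, .iff φ ψ, α, β => (φ.Realize A α β ↔ ψ.Realize A α β)
  | _, _, .allS φ, α, β => ∀ a : A, φ.Realize A (Sum.elim α (fun _ => a)) β
  | _, _, .exS φ, α, β => ∃ a : A, φ.Realize A (Sum.elim α (fun _ => a)) β
  | _, _, .allN φ, α, β => ∀ n : Num A, φ.Realize A α (Sum.elim β (fun _ => n))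
  | _, _, .exN φ, α, β => ∃ n : Num A, φ.Realize A α (Sum.elim β (fun _ => n))
  | _, _, .count s t _ ψ p, α, β =>
      Nat.card {a : Tup A s t // ψ.Realize A (Sum.elim α a.1) (Sum.elim β a.2)} =
        num (fun i => β (p i))
  | _, _, .lrec s t k _ φeq φE φC wS wN r, α, β =>
      let S : Setoid (Tup A s t) := Relation.EqvGen.setoid fun a b =>
        φeq.Realize A (Sum.elim α (Sum.elim a.1 b.1)) (Sum.elim β (Sum.elim a.2 b.2))
      let E₀ : Tup A s t → Tup A s t → Prop := fun a b =>
        φE.Realize A (Sum.elim α (Sum.elim a.1 b.1)) (Sum.elim β (Sum.elim a.2 b.2))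
      let C₀ : Tup A s t → Set ℕ := fun a =>
        {i | ∃ n : Fin (k + 1) → Num A, num n = i ∧
          φC.Realize A (Sum.elim α a.1) (Sum.elim β (Sum.elim a.2 n))}
      LRecX (quotEdge S E₀) (quotLabel S C₀) (num fun i => β (r i))
        (Quotient.mk S (fun i => α (wS i), fun i => β (wN i)))

/-- An `LREC₌[τ₁, τ₂]`-transduction of arity `s + t`, whose tuples `u` of variables consist of `s`
structure variables and `t` number variables. -/
structure Transduction (τ₁ : FirstOrder.Language.{u, v}) (τ₂ : FirstOrder.Language.{u', v'}) (s t : ℕ) where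
  /-- `θ_V(u)` -/
  univ : Formula τ₁ (Fin s) (Fin t)
  /-- `θ_≈(u, v)` -/
  equ : Formula τ₁ (Fin s ⊕ Fin s) (Fin t ⊕ Fin t)
  /-- `θ_R(u_1, ..., u_n)` for `R` of arity `n` -/
  rel : {n : ℕ} → τ₂.Relations n → Formula τ₁ (Fin n × Fin s) (Fin n × Fin t)

namespace Transduction

variable {τ₁ : FirstOrder.Language.{u, v}} {τ₂ : FirstOrder.Language.{u', v'}} {s t : ℕ} (Θ : Transduction τ₁ τ₂ s t)
  (A : Type w) [τ₁.Structure A]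

/-- The set `θ_V[A; u]`. -/
def dom : Set (Tup A s t) := {a | Θ.univ.Realize A a.1 a.2}

/-- The equivalence relation `≈` on `A^u` generated by `θ_≈[A; u, v]`. -/
def approx : Setoid (Tup A s t) := Relation.EqvGen.setoid fun a b =>
  Θ.equ.Realize A (Sum.elim a.1 b.1) (Sum.elim a.2 b.2)

/-- The equivalence class of a tuple with respect to `≈`. -/
def cls (a : Tup A s t) : Quotient (Θ.approx A) := Quotient.mk (Θ.approx A) a

/-- The universe `V(Θ[A])`, the set of `≈`-classes of the tuples in `θ_V[A; u]`. -/
def carrier : Set (Quotient (Θ.approx A)) := Θ.cls A '' Θ.dom A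

/-- The `τ₂`-structure `Θ[A]`. -/
instance instStructure [τ₂.IsRelational] : τ₂.Structure (Θ.carrier A) where
  funMap f := isEmptyElim f
  RelMap {n} R c := ∃ a : Fin n → Tup A s t, (∀ i, a i ∈ Θ.dom A) ∧
    (∀ i, Θ.cls A (a i) = (c i : Quotient (Θ.approx A))) ∧
    (Θ.rel R).Realize A (fun i => (a i.1).1 i.2) (fun i => (a i.1).2 i.2)

end Transduction

end LREC

/-! `A` can compute with `Θ[A]` through codes. An element of `Θ[A]` is coded by a representative
tuple, a number of `Θ[A]` by `s + t + 1` digits in base `|A| + 1`. By induction on its structure,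
every formula becomes a definable condition on codes (`Translatable.realize`). Codes are not unique
and some tuples code nothing, so `A` must be able to tell which tuples are codes and when two of
them code the same object; this is the notion `IsCoding`.

The recursion operator supplies what is missing. On a graph without edges it only tests a label of a
class, which makes generated equivalence relations definable (`Definable.eqvGen`). On a star whose
leaves are coded objects it counts these objects (`IsCoding.card`), whereas `#` would count their
codes. Counting the elements of `Θ[A]` gives `|Θ[A]|`, hence the range of valid numbers
(`isCoding_num`). Counting the tuples numerically below a tuple converts base `|Θ[A]| + 1` to base
`|A| + 1` (`exists_definable_num_eq`).

A recursion formula over `Θ[A]` becomes a recursion formula over codes whose `φ₌` also identifies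
codes of the same tuple. The relation `X` is preserved because it depends only on the quotient
graph, and tuples that are not codes form isolated classes, so they alter neither out-neighbours nor
in-degrees (`lRecX_decode`).

One formula must serve all structures, so definability is stated for a family of structures, finally
taken to be all finite non-empty ones. -/

namespace LREC

/-! ### Renaming of free variables -/

variable {τ : FirstOrder.Language.{u, v}}

/-- Renaming of the free variables of a formula. -/
def Formula.rename : {X P : Type} → Formula τ X P → {X' P' : Type} → (X → X') → (P → P') →
    Formula τ X' P'
  | _, _, .rel R x, _, _, f, _ => .rel R fun i => f (x i)
  | _, _, .eqS x y, _, _, f, _ => .eqS (f x) (f y)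
  | _, _, .eqN p q, _, _, _, g => .eqN (g p) (g q)
  | _, _, .leN p q, _, _, _, g => .leN (g p) (g q)
  | _, _, .not φ, _, _, f, g => .not (φ.rename f g)
  | _, _, .and φ ψ, _, _, f, g => .and (φ.rename f g) (ψ.rename f g)
  | _, _, .or φ ψ, _, _, f, g => .or (φ.rename f g) (ψ.rename f g)
  | _, _, .imp φ ψ, _, _, f, g => .imp (φ.rename f g) (ψ.rename f g)
  | _, _, .iff φ ψ, _, _, f, g => .iff (φ.rename f g) (ψ.rename f g)
  | _, _, .allS φ, _, _, f, g => .allS (φ.rename (Sum.map f id) g)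
  | _, _, .exS φ, _, _, f, g => .exS (φ.rename (Sum.map f id) g)
  | _, _, .allN φ, _, _, f, g => .allN (φ.rename f (Sum.map g id))
  | _, _, .exN φ, _, _, f, g => .exN (φ.rename f (Sum.map g id))
  | _, _, .count s t k ψ p, _, _, f, g =>
      .count s t k (ψ.rename (Sum.map f id) (Sum.map g id)) fun i => g (p i)
  | _, _, .lrec s t k m φeq φE φC wS wN r, _, _, f, g =>
      .lrec s t k m (φeq.rename (Sum.map f id) (Sum.map g id))
        (φE.rename (Sum.map f id) (Sum.map g id)) (φC.rename (Sum.map f id) (Sum.map g id))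
        (fun i => f (wS i)) (fun i => g (wN i)) fun i => g (r i)

/-- The vertex type is itself a quotient depending on `r`, so rewriting `r` in place runs into
dependent types; substituting all three equations at once avoids this. -/
theorem lRecX_quot_congr {V₀ : Type w} {r r' E E' : V₀ → V₀ → Prop} {C C' : V₀ → Set ℕ}
    (hr : r = r') (hE : E = E') (hC : C = C') (l : ℕ) (a : V₀) :
    LRecX (quotEdge (Relation.EqvGen.setoid r) E) (quotLabel (Relation.EqvGen.setoid r) C) l
        (Quotient.mk _ a) =
      LRecX (quotEdge (Relation.EqvGen.setoid r') E') (quotLabel (Relation.EqvGen.setoid r') C') l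
        (Quotient.mk _ a) := by
  subst hr hE hC
  rfl

theorem Formula.realize_rename (A : Type w) [τ.Structure A] {X P : Type} (φ : Formula τ X P)
    {X' P' : Type} (f : X → X') (g : P → P') (α : X' → A) (β : P' → Num A) :
    (φ.rename f g).Realize A α β = φ.Realize A (fun x => α (f x)) (fun p => β (g p)) := by
  have key : ∀ {B : Type w} {U V W : Type} (γ : V → B) (h : U → V) (δ : W → B),
      (fun x => Sum.elim γ δ (Sum.map h id x)) = Sum.elim (fun x => γ (h x)) δ := by
    intro B U V W γ h δ
    funext x
    cases x <;> rfl
  have keyN : ∀ {U V W : Type} (γ : V → Num A) (h : U → V) (δ : W → Num A),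
      (fun x => Sum.elim γ δ (Sum.map h id x)) = Sum.elim (fun x => γ (h x)) δ := by
    intro U V W γ h δ
    funext x
    cases x <;> rfl
  induction φ generalizing X' P' with
  | rel R x => rfl
  | eqS x y => rfl
  | eqN p q => rfl
  | leN p q => rfl
  | not φ ih => simp only [rename, Realize, ih]
  | and φ ψ ih₁ ih₂ => simp only [rename, Realize, ih₁, ih₂]
  | or φ ψ ih₁ ih₂ => simp only [rename, Realize, ih₁, ih₂]
  | imp φ ψ ih₁ ih₂ => simp only [rename, Realize, ih₁, ih₂]
  | iff φ ψ ih₁ ih₂ => simp only [rename, Realize, ih₁, ih₂]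
  | allS φ ih => simp only [rename, Realize, ih, key]
  | exS φ ih => simp only [rename, Realize, ih, key]
  | allN φ ih => simp only [rename, Realize, ih, keyN]
  | exN φ ih => simp only [rename, Realize, ih, keyN]
  | count s t k ψ p ih => simp only [rename, Realize, ih, key, keyN]
  | lrec s t k m φeq φE φC wS wN r ih₁ ih₂ ih₃ =>
      refine lRecX_quot_congr ?_ ?_ ?_ _ _ <;> simp only [ih₁, ih₂, ih₃, key, keyN]

/-! ### Closure properties of uniformly definable predicates -/

section Definable

variable {I : Type*} (A : I → Type w) [∀ i, τ.Structure (A i)]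

variable (τ) in
/-- `Q` is defined by a single `LREC₌[τ]`-formula in all structures of the family `A`. -/
def Definable {X P : Type} (Q : ∀ i, (X → A i) → (P → Num (A i)) → Prop) : Prop :=
  ∃ φ : Formula τ X P, ∀ i α β, φ.Realize (A i) α β ↔ Q i α β

variable {A}

namespace Definable

variable {X P X' P' : Type} {Q Q' : ∀ i, (X → A i) → (P → Num (A i)) → Prop}

theorem congr (h : Definable τ A Q) (H : ∀ i α β, Q i α β ↔ Q' i α β) : Definable τ A Q' := by
  obtain ⟨φ, hφ⟩ := h
  exact ⟨φ, fun i α β => (hφ i α β).trans (H i α β)⟩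

theorem realize (φ : Formula τ X P) (f : X → X') (g : P → P') :
    Definable τ A fun i α β =>
      φ.Realize (A i) (fun x => α (f x)) (fun p => β (g p)) :=
  ⟨φ.rename f g, fun i α β => by rw [Formula.realize_rename]⟩

theorem rename (h : Definable τ A Q) (f : X → X') (g : P → P') :
    Definable τ A fun i α β => Q i (fun x => α (f x)) (fun p => β (g p)) := by
  obtain ⟨φ, hφ⟩ := h
  exact (realize φ f g).congr fun i α β => hφ i _ _

theorem not (h : Definable τ A Q) : Definable τ A fun i α β => ¬ Q i α β := by
  obtain ⟨φ, hφ⟩ := h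
  exact ⟨.not φ, fun i α β => not_congr (hφ i α β)⟩

theorem and (h : Definable τ A Q) (h' : Definable τ A Q') :
    Definable τ A fun i α β => Q i α β ∧ Q' i α β := by
  obtain ⟨φ, hφ⟩ := h
  obtain ⟨ψ, hψ⟩ := h'
  exact ⟨.and φ ψ, fun i α β => and_congr (hφ i α β) (hψ i α β)⟩

theorem or (h : Definable τ A Q) (h' : Definable τ A Q') :
    Definable τ A fun i α β => Q i α β ∨ Q' i α β := by
  obtain ⟨φ, hφ⟩ := h
  obtain ⟨ψ, hψ⟩ := h'
  exact ⟨.or φ ψ, fun i α β => or_congr (hφ i α β) (hψ i α β)⟩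

theorem eqS (x y : X) : Definable τ A fun i α (_ : P → Num (A i)) => α x = α y :=
  ⟨.eqS x y, fun _ _ _ => Iff.rfl⟩

theorem eqN (p q : P) : Definable τ A fun i (_ : X → A i) β => β p = β q :=
  ⟨.eqN p q, fun _ _ _ => Iff.rfl⟩

theorem leN (p q : P) : Definable τ A fun i (_ : X → A i) β => β p ≤ β q :=
  ⟨.leN p q, fun _ _ _ => Iff.rfl⟩

theorem true : Definable τ A fun i (_ : X → A i) (_ : P → Num (A i)) => True :=
  ⟨.allN (.eqN (.inr 0) (.inr 0)), fun _ _ _ => iff_true_intro fun _ => rfl⟩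

theorem false : Definable τ A fun i (_ : X → A i) (_ : P → Num (A i)) => False :=
  true.not.congr fun _ _ _ => not_true

theorem finite_all {J : Type*} [Finite J] {Q : J → ∀ i, (X → A i) → (P → Num (A i)) → Prop}
    (h : ∀ j, Definable τ A (Q j)) : Definable τ A fun i α β => ∀ j, Q j i α β := by
  have := Fintype.ofFinite J
  have key : ∀ s : Finset J, Definable τ A fun i α β => ∀ j ∈ s, Q j i α β := by
    classical
    intro s
    induction s using Finset.induction_on with
    | empty => exact true.congr fun i α β => by simp
    | insert a s _ ih => exact ((h a).and ih).congr fun i α β => by simp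
  exact (key Finset.univ).congr fun i α β => by simp

theorem finite_exists {J : Type*} [Finite J] {Q : J → ∀ i, (X → A i) → (P → Num (A i)) → Prop}
    (h : ∀ j, Definable τ A (Q j)) : Definable τ A fun i α β => ∃ j, Q j i α β :=
  (finite_all fun j => (h j).not).not.congr fun i α β => by simp

theorem forallN {R : ∀ i, (X → A i) → (P → Num (A i)) → Num (A i) → Prop}
    (h : Definable τ A (X := X) (P := P ⊕ Fin 1) fun i α β =>
      R i α (fun p => β (.inl p)) (β (.inr 0))) :
    Definable τ A fun i α β => ∀ n, R i α β n := by
  obtain ⟨φ, hφ⟩ := h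
  exact ⟨.allN φ, fun i α β => forall_congr' fun n => hφ i _ _⟩

theorem eq_zero (p : P) : Definable τ A fun i (_ : X → A i) β => β p = 0 :=
  (forallN (R := fun i _ β n => β p ≤ n) (leN (Sum.inl p) (Sum.inr 0))).congr fun _ _ _ =>
    ⟨fun h => le_antisymm (h 0) (Fin.zero_le _), fun h n => h ▸ Fin.zero_le n⟩

theorem eq_last (p : P) : Definable τ A fun i (_ : X → A i) β => β p = Fin.last _ :=
  (forallN (R := fun i _ β n => n ≤ β p) (leN (Sum.inr 0) (Sum.inl p))).congr fun _ _ _ =>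
    ⟨fun h => le_antisymm (Fin.le_last _) (h _), fun h n => h ▸ Fin.le_last n⟩

/-- Existential quantification over a finite block of variables of both sorts. -/
theorem exists_block [∀ i, Finite (A i)] {Y Z : Type} [Finite Y] [Finite Z]
    {R : ∀ i, (X → A i) → (P → Num (A i)) → (Y → A i) → (Z → Num (A i)) → Prop}
    (h : Definable τ A (X := X ⊕ Y) (P := P ⊕ Z) fun i α β =>
      R i (fun x => α (.inl x)) (fun p => β (.inl p)) (fun y => α (.inr y)) fun z => β (.inr z)) :
    Definable τ A fun i α β => ∃ y z, R i α β y z := by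
  obtain ⟨s, ⟨e⟩⟩ := Finite.exists_equiv_fin Y
  obtain ⟨t, ⟨e'⟩⟩ := Finite.exists_equiv_fin Z
  obtain ⟨φ, hφ⟩ := h.rename (X' := X ⊕ Fin s) (P' := P ⊕ Fin t) (Sum.map id e) (Sum.map id e')
  -- The empty number tuple denotes `0`, so this says that the number of witnesses is not zero. As
  -- `Nat.card` is also `0` on infinite types, finiteness of `A i` is needed.
  refine ⟨.not (.count s t 0 φ Fin.elim0), fun i α β => ?_⟩
  simp only [Formula.Realize, hφ, num, Finset.univ_eq_empty, Finset.sum_empty]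
  rw [Nat.card_eq_zero, not_or, not_isEmpty_iff, not_infinite_iff_finite]
  constructor
  · rintro ⟨⟨a, ha⟩, -⟩
    exact ⟨fun y => a.1 (e y), fun z => a.2 (e' z), ha⟩
  · rintro ⟨y, z, H⟩
    refine ⟨⟨(fun j => y (e.symm j), fun j => z (e'.symm j)), ?_⟩, inferInstance⟩
    simpa using H

theorem existsN [∀ i, Finite (A i)] {Z : Type} [Finite Z]
    {R : ∀ i, (X → A i) → (P → Num (A i)) → (Z → Num (A i)) → Prop}
    (h : Definable τ A (X := X) (P := P ⊕ Z) fun i α β =>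
      R i α (fun p => β (.inl p)) fun z => β (.inr z)) :
    Definable τ A fun i α β => ∃ z, R i α β z :=
  (exists_block (Y := Empty) (R := fun i α β _ z => R i α β z)
    (h.rename Sum.inl id)).congr fun i α β =>
      ⟨fun ⟨_, z, hz⟩ => ⟨z, hz⟩, fun ⟨z, hz⟩ => ⟨nofun, z, hz⟩⟩

theorem realize_lrec {s t k m : ℕ} {X P : Type}
    {Req RE : ∀ i, (X → A i) → (P → Num (A i)) → Tup (A i) s t → Tup (A i) s t → Prop}
    {RC : ∀ i, (X → A i) → (P → Num (A i)) → Tup (A i) s t → (Fin (k + 1) → Num (A i)) → Prop}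
    (heq : Definable τ A (X := X ⊕ (Fin s ⊕ Fin s)) (P := P ⊕ (Fin t ⊕ Fin t)) fun i α β =>
      Req i (fun x => α (.inl x)) (fun p => β (.inl p))
        (fun y => α (.inr (.inl y)), fun z => β (.inr (.inl z)))
        (fun y => α (.inr (.inr y)), fun z => β (.inr (.inr z))))
    (hE : Definable τ A (X := X ⊕ (Fin s ⊕ Fin s)) (P := P ⊕ (Fin t ⊕ Fin t)) fun i α β =>
      RE i (fun x => α (.inl x)) (fun p => β (.inl p))
        (fun y => α (.inr (.inl y)), fun z => β (.inr (.inl z)))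
        (fun y => α (.inr (.inr y)), fun z => β (.inr (.inr z))))
    (hC : Definable τ A (X := X ⊕ Fin s) (P := P ⊕ (Fin t ⊕ Fin (k + 1))) fun i α β =>
      RC i (fun x => α (.inl x)) (fun p => β (.inl p))
        (fun y => α (.inr y), fun z => β (.inr (.inl z))) fun j => β (.inr (.inr j)))
    (wS : Fin s → X) (wN : Fin t → P) (r : Fin (m + 1) → P) :
    Definable τ A fun i α β =>
      LRecX (quotEdge (Relation.EqvGen.setoid (Req i α β)) (RE i α β))
        (quotLabel (Relation.EqvGen.setoid (Req i α β))
          fun a => {j | ∃ n, num n = j ∧ RC i α β a n})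
        (num fun j => β (r j))
        (Quotient.mk _ (fun j => α (wS j), fun j => β (wN j))) := by
  obtain ⟨φ, hφ⟩ := heq
  obtain ⟨ψ, hψ⟩ := hE
  obtain ⟨χ, hχ⟩ := hC
  refine ⟨.lrec s t k m φ ψ χ wS wN r, fun i α β => ?_⟩
  refine (lRecX_quot_congr (r' := Req i α β) (E' := RE i α β) ?_ ?_ ?_ _ _).to_iff
  · exact funext₂ fun a b => propext (hφ i _ _)
  · exact funext₂ fun a b => propext (hψ i _ _)
  · exact funext fun a => Set.ext fun j => exists_congr fun n => and_congr_right fun _ => hχ i _ _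

end Definable

end Definable

end LREC

/-! ### Transfer of the recursion along a decoding, and definability of generated equivalences -/

namespace LREC

/-- By `hS` the class of a code is exactly the fibre of `D` over the decoded vertex, so `V` embeds
into the quotient. By `hE₀` the remaining classes have no edges. Hence out-neighbours and in-degrees
correspond, and the two recursions agree by strong induction on `l`. -/
theorem lRecX_decode {V₀ : Type*} {V : Type*} {S : Setoid V₀} {E₀ : V₀ → V₀ → Prop}
    {C₀ : V₀ → Set ℕ} {E : V → V → Prop} {C : V → Set ℕ} {D : V₀ → V → Prop}
    (surj : ∀ a, ∃ x, D x a) (hfun : ∀ {x a b}, D x a → D x b → a = b)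
    (hS : ∀ {x y a}, D x a → (S x y ↔ D y a))
    (hE₀ : ∀ {x y}, E₀ x y → ∃ a b, D x a ∧ D y b ∧ E a b)
    (hE : ∀ {a b}, E a b → ∃ x y, D x a ∧ D y b ∧ E₀ x y)
    (hC : ∀ {a n}, n ∈ C a ↔ ∃ x, D x a ∧ n ∈ C₀ x) (l : ℕ) {x : V₀} {a : V} (hx : D x a) :
    LRecX (quotEdge S E₀) (quotLabel S C₀) l (Quotient.mk S x) ↔ LRecX E C l a := by
  choose f hf using surj
  have hF : ∀ {y b}, Quotient.mk S y = Quotient.mk S (f b) ↔ D y b := fun {y b} =>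
    ⟨fun h => (hS (hf b)).1 (Quotient.exact h.symm), fun h => (Quotient.sound ((hS (hf b)).2 h)).symm⟩
  have hinj : ∀ {b c}, Quotient.mk S (f b) = Quotient.mk S (f c) → b = c := fun {b c} h =>
    hfun (hf b) (hF.1 h)
  have hto : ∀ {b c}, E b c → quotEdge S E₀ (Quotient.mk S (f b)) (Quotient.mk S (f c)) := by
    intro b c h
    obtain ⟨y, z, hy, hz, h⟩ := hE h
    exact ⟨y, z, hF.2 hy, hF.2 hz, h⟩
  have hofl : ∀ {b d}, quotEdge S E₀ (Quotient.mk S (f b)) d →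
      ∃ c, Quotient.mk S (f c) = d ∧ E b c := by
    rintro b d ⟨y, z, hy, hz, h⟩
    obtain ⟨b', c, hb', hc, h⟩ := hE₀ h
    obtain rfl := hfun hb' (hF.1 hy)
    exact ⟨c, (hF.2 hc).symm.trans hz, h⟩
  have hofr : ∀ {d c}, quotEdge S E₀ d (Quotient.mk S (f c)) →
      ∃ b, Quotient.mk S (f b) = d ∧ E b c := by
    rintro d c ⟨y, z, hy, hz, h⟩
    obtain ⟨b, c', hb, hc', h⟩ := hE₀ h
    obtain rfl := hfun hc' (hF.1 hz)
    exact ⟨b, (hF.2 hb).symm.trans hy, h⟩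
  have hdeg : ∀ c, Nat.card {d // quotEdge S E₀ d (Quotient.mk S (f c))} =
      Nat.card {b // E b c} := by
    intro c
    refine (Nat.card_eq_of_bijective
      (fun b : {b // E b c} => (⟨Quotient.mk S (f b.1), hto b.2⟩ :
        {d // quotEdge S E₀ d (Quotient.mk S (f c))})) ⟨?_, ?_⟩).symm
    · rintro ⟨b, hb⟩ ⟨b', hb'⟩ h
      exact Subtype.ext (hinj (congrArg Subtype.val h))
    · rintro ⟨d, hd⟩
      obtain ⟨b, rfl, hb⟩ := hofr hd
      exact ⟨⟨b, hb⟩, rfl⟩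
  -- Passing to the chosen code `f a` makes the claim a statement about `a` alone, as the induction
  -- needs.
  rw [hF.2 hx]
  clear hx x
  induction l using Nat.strong_induction_on generalizing a with
  | _ l ih =>
    rw [lRecX_iff, lRecX_iff]
    refine and_congr_right fun hl => ?_
    have hlt : ∀ c, (l - 1) / Nat.card {b // E b c} < l := fun c =>
      (Nat.div_le_self _ _).trans_lt (Nat.sub_lt hl one_pos)
    have hcard : Nat.card {d // quotEdge S E₀ (Quotient.mk S (f a)) d ∧
          LRecX (quotEdge S E₀) (quotLabel S C₀)
            ((l - 1) / Nat.card {c // quotEdge S E₀ c d}) d} =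
        Nat.card {b // E a b ∧ LRecX E C ((l - 1) / Nat.card {c // E c b}) b} := by
      refine (Nat.card_eq_of_bijective
        (fun b : {b // E a b ∧ LRecX E C ((l - 1) / Nat.card {c // E c b}) b} =>
          (⟨Quotient.mk S (f b.1), hto b.2.1, by
            rw [hdeg]
            exact (ih _ (hlt b)).2 b.2.2⟩ : {d // quotEdge S E₀ (Quotient.mk S (f a)) d ∧
          LRecX (quotEdge S E₀) (quotLabel S C₀)
            ((l - 1) / Nat.card {c // quotEdge S E₀ c d}) d})) ⟨?_, ?_⟩).symm
      · rintro ⟨b, hb⟩ ⟨b', hb'⟩ h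
        exact Subtype.ext (hinj (congrArg Subtype.val h))
      · rintro ⟨d, hd, hd'⟩
        obtain ⟨b, rfl, hb⟩ := hofl hd
        rw [hdeg] at hd'
        exact ⟨⟨b, hb, (ih _ (hlt b)).1 hd'⟩, rfl⟩
    rw [hcard]
    generalize Nat.card _ = N
    rw [hC]
    exact exists_congr fun y => and_congr_left fun _ => hF

/-- With `lRecX_decode` in view: the generated equivalence cannot leave a fibre of `D` if no
generating pair does. -/
theorem eqvGen_decode {V₀ : Type*} {V : Type*} {D : V₀ → V → Prop}
    {r : V₀ → V₀ → Prop} (hr : ∀ {x y}, r x y → ∀ a, D x a ↔ D y a) {x y : V₀}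
    (h : Relation.EqvGen r x y) (a : V) : D x a ↔ D y a := by
  induction h with
  | rel x y h => exact hr h a
  | refl x => rfl
  | symm x y _ ih => exact ih.symm
  | trans x y z _ _ ih₁ ih₂ => exact ih₁.trans ih₂

theorem eqvGen_map {V W : Type*} {r : V → V → Prop} {r' : W → W → Prop} (f : V → W)
    (h : ∀ x y, r x y → r' (f x) (f y)) {x y : V} (hxy : Relation.EqvGen r x y) :
    Relation.EqvGen r' (f x) (f y) := by
  induction hxy with
  | rel x y hxy => exact .rel _ _ (h x y hxy)
  | refl x => exact .refl _
  | symm x y _ ih => exact .symm _ _ ih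
  | trans x y z _ _ ih₁ ih₂ => exact .trans _ _ _ ih₁ ih₂

theorem last_pos (B : Type w) [Finite B] [Nonempty B] : 0 < ((Fin.last _ : Num B) : ℕ) :=
  Nat.card_pos (α := B)

variable {τ : FirstOrder.Language.{u, v}} {I : Type*} {A : I → Type w} [∀ i, τ.Structure (A i)]

/-- The values of a block consisting of structure variables `Y` and number variables `Z`. -/
abbrev Block (A : Type w) (Y Z : Type) : Type w := (Y → A) × (Z → Num A)

namespace Definable

/-- Codes are indexed by products and sums rather than by `Fin s`; reindexing by a bijection is a
decoding, so `lRecX_decode` applies. -/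
theorem lrec {k m : ℕ} {X P Y Z : Type} [Finite Y] [Finite Z]
    {Req RE : ∀ i, (X → A i) → (P → Num (A i)) → Block (A i) Y Z → Block (A i) Y Z → Prop}
    {RC : ∀ i, (X → A i) → (P → Num (A i)) → Block (A i) Y Z → (Fin (k + 1) → Num (A i)) → Prop}
    (heq : Definable τ A (X := X ⊕ (Y ⊕ Y)) (P := P ⊕ (Z ⊕ Z)) fun i α β =>
      Req i (fun x => α (.inl x)) (fun p => β (.inl p))
        (fun y => α (.inr (.inl y)), fun z => β (.inr (.inl z)))
        (fun y => α (.inr (.inr y)), fun z => β (.inr (.inr z))))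
    (hE : Definable τ A (X := X ⊕ (Y ⊕ Y)) (P := P ⊕ (Z ⊕ Z)) fun i α β =>
      RE i (fun x => α (.inl x)) (fun p => β (.inl p))
        (fun y => α (.inr (.inl y)), fun z => β (.inr (.inl z)))
        (fun y => α (.inr (.inr y)), fun z => β (.inr (.inr z))))
    (hC : Definable τ A (X := X ⊕ Y) (P := P ⊕ (Z ⊕ Fin (k + 1))) fun i α β =>
      RC i (fun x => α (.inl x)) (fun p => β (.inl p))
        (fun y => α (.inr y), fun z => β (.inr (.inl z))) fun j => β (.inr (.inr j)))
    (wS : Y → X) (wN : Z → P) (r : Fin (m + 1) → P) :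
    Definable τ A fun i α β =>
      LRecX (quotEdge (Relation.EqvGen.setoid (Req i α β)) (RE i α β))
        (quotLabel (Relation.EqvGen.setoid (Req i α β))
          fun a => {j | ∃ n, num n = j ∧ RC i α β a n})
        (num fun j => β (r j))
        (Quotient.mk _ (fun j => α (wS j), fun j => β (wN j))) := by
  obtain ⟨s, ⟨e⟩⟩ := Finite.exists_equiv_fin Y
  obtain ⟨t, ⟨e'⟩⟩ := Finite.exists_equiv_fin Z
  let g : ∀ i, Tup (A i) s t → Block (A i) Y Z := fun i x => (fun y => x.1 (e y), fun z => x.2 (e' z))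
  let g' : ∀ i, Block (A i) Y Z → Tup (A i) s t := fun i x =>
    (fun y => x.1 (e.symm y), fun z => x.2 (e'.symm z))
  have gg' : ∀ i x, g i (g' i x) = x := fun i x => by simp [g, g']
  have g'g : ∀ i x, g' i (g i x) = x := fun i x => by simp [g, g']
  refine (realize_lrec (τ := τ) (A := A) (X := X) (P := P) (s := s) (t := t) (k := k) (m := m)
    (Req := fun i α β x y => Req i α β (g i x) (g i y))
    (RE := fun i α β x y => RE i α β (g i x) (g i y))
    (RC := fun i α β x n => RC i α β (g i x) n)
    (heq.rename (Sum.map id (Sum.map e e)) (Sum.map id (Sum.map e' e')))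
    (hE.rename (Sum.map id (Sum.map e e)) (Sum.map id (Sum.map e' e')))
    (hC.rename (Sum.map id e) (Sum.map id (Sum.map e' id)))
    (fun j => wS (e.symm j)) (fun j => wN (e'.symm j)) r).congr fun i α β => ?_
  have hmk : ∀ x y : Tup (A i) s t,
      Relation.EqvGen (fun x y => Req i α β (g i x) (g i y)) x y ↔
        Relation.EqvGen (Req i α β) (g i x) (g i y) := by
    intro x y
    refine ⟨fun h => eqvGen_map (g i) (fun _ _ h => h) h, fun h => ?_⟩
    have := eqvGen_map (r' := fun x y => Req i α β (g i x) (g i y)) (g' i)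
      (fun x y h => by rwa [gg', gg']) h
    rwa [g'g, g'g] at this
  refine lRecX_decode
    (D := fun x c => Quotient.mk (Relation.EqvGen.setoid (Req i α β)) (g i x) = c)
    ?_ ?_ ?_ ?_ ?_ ?_ _ ?_
  · intro c
    obtain ⟨a, rfl⟩ := Quotient.exists_rep c
    exact ⟨g' i a, by rw [gg']⟩
  · rintro x a b rfl rfl
    rfl
  · rintro x y a rfl
    exact (hmk x y).trans ⟨fun h => (Quotient.sound h).symm, fun h => Quotient.exact h.symm⟩
  · intro x y h
    exact ⟨_, _, rfl, rfl, _, _, rfl, rfl, h⟩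
  · rintro a b ⟨x, y, rfl, rfl, h⟩
    exact ⟨g' i x, g' i y, by rw [gg'], by rw [gg'], by rwa [gg', gg']⟩
  · intro c n
    constructor
    · rintro ⟨a, rfl, h⟩
      exact ⟨g' i a, by rw [gg'], by simpa only [Set.mem_ofPred_eq, gg'] using h⟩
    · rintro ⟨x, rfl, h⟩
      exact ⟨_, rfl, h⟩
  · simp [g]

variable [∀ i, Finite (A i)] [∀ i, Nonempty (A i)]

/-- The equivalence relation generated by a definable relation is definable. -/
theorem eqvGen {X P Y Z : Type} [Finite Y] [Finite Z]
    {Req : ∀ i, (X → A i) → (P → Num (A i)) → Block (A i) Y Z → Block (A i) Y Z → Prop}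
    (heq : Definable τ A (X := X ⊕ (Y ⊕ Y)) (P := P ⊕ (Z ⊕ Z)) fun i α β =>
      Req i (fun x => α (.inl x)) (fun p => β (.inl p))
        (fun y => α (.inr (.inl y)), fun z => β (.inr (.inl z)))
        (fun y => α (.inr (.inr y)), fun z => β (.inr (.inr z))))
    (wS wS' : Y → X) (wN wN' : Z → P) :
    Definable τ A fun i α β => Relation.EqvGen (Req i α β)
      (fun j => α (wS j), fun j => β (wN j)) (fun j => α (wS' j), fun j => β (wN' j)) := by
  -- Without edges the number of out-neighbours is `0`, so `(c, l) ∈ X` means `0 < l` and `0 ∈ C c`.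
  -- Only the target tuple carries the label `0`, so the test succeeds exactly on its class.
  have h := lrec (τ := τ) (A := A) (k := 0) (m := 0) (X := X) (P := P ⊕ Fin 1)
    (Req := fun i α β => Req i α fun p => β (.inl p)) (RE := fun _ _ _ _ _ => False)
    (RC := fun i α β x n => ((∀ j, x.1 j = α (wS' j)) ∧ ∀ j, x.2 j = β (.inl (wN' j))) ∧ n 0 = 0)
    (heq.rename id (Sum.map Sum.inl id)) false
    (((finite_all fun j => eqS (Sum.inr j) (Sum.inl (wS' j))).and
      (finite_all fun j => eqN (Sum.inr (Sum.inl j)) (Sum.inl (Sum.inl (wN' j))))).and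
      (eq_zero (Sum.inr (Sum.inr 0))))
    wS (fun j => Sum.inl (wN j)) (fun _ => Sum.inr 0)
  -- The recursion needs a positive resource; the largest number `|A|` is positive because `A` is
  -- non-empty.
  refine (existsN (Z := Fin 1) (R := fun i α β z => z 0 = Fin.last _ ∧
    LRecX (quotEdge (Relation.EqvGen.setoid (Req i α β)) fun _ _ => False)
        (quotLabel (Relation.EqvGen.setoid (Req i α β)) fun x => {j | ∃ n : Fin 1 → Num (A i),
          num n = j ∧ ((∀ j, x.1 j = α (wS' j)) ∧ ∀ j, x.2 j = β (wN' j)) ∧ n 0 = 0})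
        (num fun _ : Fin 1 => z 0)
        (Quotient.mk _ (fun j => α (wS j), fun j => β (wN j))))
    ((eq_last (Sum.inr 0)).and h)).congr fun i α β => ?_
  have hq : ∀ (S : Setoid (Block (A i) Y Z)) (a b : Quotient S),
      quotEdge S (fun _ _ => False) a b ↔ False := fun S a b =>
    ⟨fun ⟨_, _, _, _, h⟩ => h, _root_.False.elim⟩
  have hX : ∀ (S : Setoid (Block (A i) Y Z)) (C : Quotient S → Set ℕ) (l : ℕ) (c : Quotient S),
      LRecX (quotEdge S fun _ _ => False) C l c ↔ 0 < l ∧ 0 ∈ C c := fun S C l c => by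
    rw [lRecX_iff]
    simp only [hq, false_and, Nat.card_of_isEmpty]
  simp only [hX]
  constructor
  · rintro ⟨z, -, -, x, hx, n, -, ⟨h₁, h₂⟩, -⟩
    have : x = (fun j => α (wS' j), fun j => β (wN' j)) := Prod.ext (funext h₁) (funext h₂)
    rw [← this]
    exact Quotient.exact hx.symm
  · intro H
    refine ⟨fun _ => Fin.last _, rfl, ?_, _, (Quotient.sound H).symm, fun _ => 0, ?_,
      ⟨fun _ => rfl, fun _ => rfl⟩, rfl⟩
    · simp [num]
    · simp [num]

end Definable

end LREC

/-! ### Positional numerals, codings, and counting coded objects -/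

namespace LREC

section Num

variable {B : Type w} {k : ℕ}

theorem num_eq (n : Fin k → Num B) : num n = finFunctionFinEquiv n := by
  rw [finFunctionFinEquiv_apply]
  rfl

theorem num_injective : Function.Injective (num : (Fin k → Num B) → ℕ) := fun n n' h => by
  rw [num_eq, num_eq] at h
  exact finFunctionFinEquiv.injective (Fin.ext h)

theorem num_lt (n : Fin k → Num B) : num n < (Nat.card B + 1) ^ k := by
  rw [num_eq]
  exact Fin.isLt _

theorem exists_num_eq {m : ℕ} (h : m < (Nat.card B + 1) ^ k) : ∃ n : Fin k → Num B, num n = m := by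
  obtain ⟨n, hn⟩ := finFunctionFinEquiv.surjective (⟨m, h⟩ : Fin ((Nat.card B + 1) ^ k))
  exact ⟨n, by rw [num_eq, hn]⟩

theorem num_succ (n : Fin (k + 1) → Num B) :
    num n = num (fun j => n (Fin.castSucc j)) + n (Fin.last k) * (Nat.card B + 1) ^ k := by
  simp [num, Fin.sum_univ_castSucc]

/-- Digits are listed least significant first, so the highest differing index decides: the lower
digits together stay below one unit of the top digit. -/
theorem num_lt_num_iff {n n' : Fin k → Num B} :
    num n < num n' ↔ ∃ j, n j < n' j ∧ ∀ j', j < j' → n j' = n' j' := by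
  induction k with
  | zero => simp [num]
  | succ k ih =>
    rw [num_succ, num_succ, Fin.exists_fin_succ']
    have h₁ := num_lt fun j => n (Fin.castSucc j)
    have h₂ := num_lt fun j => n' (Fin.castSucc j)
    generalize hM : (Nat.card B + 1) ^ k = M at h₁ h₂
    have h₃ : ∀ j' : Fin (k + 1), Fin.last k < j' → n j' = n' j' := fun j' h =>
      absurd h (Fin.le_last j').not_gt
    simp only [Fin.forall_fin_succ', Fin.castSucc_lt_castSucc_iff, Fin.castSucc_lt_last,
      true_implies]
    rcases lt_trichotomy (n (Fin.last k)) (n' (Fin.last k)) with h | h | h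
    · have : (n (Fin.last k) + 1 : ℕ) * M ≤ n' (Fin.last k) * M := Nat.mul_le_mul_right _ h
      rw [add_mul, one_mul] at this
      exact iff_of_true (by omega) (.inr ⟨h, by
        simpa only [Fin.forall_fin_succ', Fin.castSucc_lt_castSucc_iff] using h₃⟩)
    · rw [h, Nat.add_lt_add_iff_right, ih]
      simp
    · have : (n' (Fin.last k) + 1 : ℕ) * M ≤ n (Fin.last k) * M := Nat.mul_le_mul_right _ h
      rw [add_mul, one_mul] at this
      refine iff_of_false (by omega) ?_
      rintro (⟨j, -, -, h'⟩ | ⟨h', -⟩)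
      · exact h.ne' h'
      · exact lt_asymm h h'

end Num

/-- The centre `none` points to the `a` with `p a`. Such a leaf has in-degree `1`, so it receives
the resource `l - 1`, which is positive by `hl`; having no out-neighbours and label `0`, it is in
`X`. The centre therefore compares the number of its leaves with `N`. -/
theorem lRecX_star {T : Type*} (p : T → Prop) (N : ℕ) {l : ℕ} (hl : 2 ≤ l) :
    LRecX (fun b c : Option T => ∃ a, b = none ∧ c = some a ∧ p a)
      (fun b => b.elim {N} fun _ => {0}) l none ↔ Nat.card {a // p a} = N := by
  have leaf : ∀ (l : ℕ) (a : T), LRecX (fun b c : Option T => ∃ a, b = none ∧ c = some a ∧ p a)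
      (fun b => b.elim {N} fun _ => {0}) l (some a) ↔ 0 < l := by
    intro l a
    rw [lRecX_iff]
    simp
  rw [lRecX_iff, and_iff_right (by omega)]
  have hcard : Nat.card {b : Option T // (∃ a, (none : Option T) = none ∧ b = some a ∧ p a) ∧
      LRecX (fun b c : Option T => ∃ a, b = none ∧ c = some a ∧ p a)
        (fun b => b.elim {N} fun _ => {0})
        ((l - 1) / Nat.card {c : Option T // ∃ a, c = none ∧ b = some a ∧ p a}) b} =
      Nat.card {a // p a} := by
    have hdeg : ∀ a, p a →
        Nat.card {c : Option T // ∃ a', c = none ∧ some a = some a' ∧ p a'} = 1 := by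
      intro a ha
      rw [Nat.card_eq_one_iff_exists]
      exact ⟨⟨none, a, rfl, rfl, ha⟩, fun ⟨c, _, hc, _⟩ => Subtype.ext hc⟩
    refine (Nat.card_eq_of_bijective (fun a : {a // p a} => ⟨some a.1, ⟨a.1, rfl, rfl, a.2⟩, by
        rw [leaf, hdeg _ a.2]
        omega⟩) ⟨?_, ?_⟩).symm
    · intro a b h
      exact Subtype.ext (Option.some_injective _ (congrArg Subtype.val h))
    · rintro ⟨_, ⟨a, -, rfl, ha⟩, -⟩
      exact ⟨⟨a, ha⟩, rfl⟩
  rw [hcard]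
  rfl

variable {τ : FirstOrder.Language.{u, v}} {I : Type*} {A : I → Type w} [∀ i, τ.Structure (A i)]

namespace Definable

variable {X P : Type}

theorem num_eq_num {k : ℕ} (p q : Fin k → P) :
    Definable τ A fun i (_ : X → A i) β => num (fun j => β (p j)) = num fun j => β (q j) :=
  (finite_all fun j => eqN (p j) (q j)).congr fun i α β =>
    ⟨fun h => congrArg num (funext h), fun h => congrFun (num_injective h)⟩

theorem ltN (p q : P) : Definable τ A fun i (_ : X → A i) β => β p < β q :=
  (leN q p).not.congr fun _ _ _ => not_le

theorem num_lt_num {k : ℕ} (p q : Fin k → P) :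
    Definable τ A fun i (_ : X → A i) β => num (fun j => β (p j)) < num fun j => β (q j) :=
  (finite_exists fun j => (ltN (p j) (q j)).and <|
    finite_all fun j' : {j' // j < j'} => eqN (p j') (q j')).congr fun _ _ _ => by
      simp only [num_lt_num_iff, Subtype.forall]

end Definable

variable (τ) in
/-- `D` is a decoding of blocks of values from `A` such that denoting the same object is
definable. -/
structure IsCoding {Y Z : Type} {T : I → Type*} (D : ∀ i, Block (A i) Y Z → T i → Prop) : Prop where
  surj : ∀ i a, ∃ x, D i x a
  unique : ∀ {i x a b}, D i x a → D i x b → a = b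
  ker : Definable τ A (X := Y ⊕ Y) (P := Z ⊕ Z) fun i α β => ∃ a,
    D i (fun y => α (.inl y), fun z => β (.inl z)) a ∧
      D i (fun y => α (.inr y), fun z => β (.inr z)) a

namespace IsCoding

variable {Y Z : Type} {T : I → Type*} {D : ∀ i, Block (A i) Y Z → T i → Prop} {X P : Type}

theorem same (hD : IsCoding τ D) (y y' : Y → X) (z z' : Z → P) :
    Definable τ A fun i α β => ∃ a,
      D i (fun j => α (y j), fun j => β (z j)) a ∧ D i (fun j => α (y' j), fun j => β (z' j)) a :=
  hD.ker.rename (Sum.elim y y') (Sum.elim z z')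

theorem valid (hD : IsCoding τ D) (y : Y → X) (z : Z → P) :
    Definable τ A fun i α β => ∃ a, D i (fun j => α (y j), fun j => β (z j)) a :=
  (hD.same y y z z).congr fun i α β => exists_congr fun a => and_self_iff

/-- Counting the objects having a code in a definable set. -/
theorem card [∀ i, Finite (A i)] [∀ i, Nonempty (A i)] [Finite Y] [Finite Z]
    (hD : IsCoding τ D) {k : ℕ}
    {R : ∀ i, (X → A i) → (P → Num (A i)) → Block (A i) Y Z → Prop}
    (hR : Definable τ A (X := X ⊕ Y) (P := P ⊕ Z) fun i α β =>
      R i (fun x => α (.inl x)) (fun p => β (.inl p)) (fun y => α (.inr y), fun z => β (.inr z)))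
    (q : Fin (k + 1) → P) :
    Definable τ A fun i α β =>
      Nat.card {a // ∃ x, D i x a ∧ R i α β x} = num fun j => β (q j) := by
  -- The star of `lRecX_star` is built on codes with an extra tag: tag `0` marks the centre, the
  -- largest number marks a leaf, and `pr` forgets the tag. Blocks with another tag, or leaf-tagged
  -- blocks coding nothing, are isolated.
  let pr : ∀ i, Block (A i) Y (Z ⊕ Fin 1) → Block (A i) Y Z := fun i x =>
    (x.1, fun z => x.2 (.inl z))
  let Req : ∀ i, Block (A i) Y (Z ⊕ Fin 1) → Block (A i) Y (Z ⊕ Fin 1) → Prop := fun i x y =>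
    (x.2 (.inr 0) = 0 ∧ y.2 (.inr 0) = 0) ∨ (x.2 (.inr 0) = Fin.last _ ∧ y.2 (.inr 0) = Fin.last _) ∧
      ∃ a, D i (pr i x) a ∧ D i (pr i y) a
  let RE : ∀ i, (X → A i) → (P → Num (A i)) → Block (A i) Y (Z ⊕ Fin 1) →
      Block (A i) Y (Z ⊕ Fin 1) → Prop := fun i α β x y =>
    x.2 (.inr 0) = 0 ∧ y.2 (.inr 0) = Fin.last _ ∧ (∃ a, D i (pr i y) a) ∧ R i α β (pr i y)
  let RC : ∀ i, (P → Num (A i)) → Block (A i) Y (Z ⊕ Fin 1) → (Fin (k + 1) → Num (A i)) → Prop :=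
    fun i β x n => (x.2 (.inr 0) = 0 ∧ ∀ j, n j = β (q j)) ∨
      (x.2 (.inr 0) = Fin.last _ ∧ ∀ j, n j = 0)
  have key := Definable.lrec (τ := τ) (A := A) (X := X ⊕ Y) (P := P ⊕ ((Z ⊕ Fin 1) ⊕ Fin 2))
    (Y := Y) (Z := Z ⊕ Fin 1) (k := k) (m := 1) (Req := fun i _ _ => Req i)
    (RE := fun i α β => RE i (fun x => α (.inl x)) fun p => β (.inl p))
    (RC := fun i α β => RC i fun p => β (.inl p))
    (((Definable.eq_zero (Sum.inr (Sum.inl (Sum.inr 0)))).and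
      (Definable.eq_zero (Sum.inr (Sum.inr (Sum.inr 0))))).or
      (((Definable.eq_last (Sum.inr (Sum.inl (Sum.inr 0)))).and
      (Definable.eq_last (Sum.inr (Sum.inr (Sum.inr 0))))).and
      (hD.same (fun y => Sum.inr (Sum.inl y)) (fun y => Sum.inr (Sum.inr y))
        (fun z => Sum.inr (Sum.inl (Sum.inl z))) (fun z => Sum.inr (Sum.inr (Sum.inl z))))))
    ((Definable.eq_zero (Sum.inr (Sum.inl (Sum.inr 0)))).and <|
      (Definable.eq_last (Sum.inr (Sum.inr (Sum.inr 0)))).and <|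
      (hD.valid (fun y => Sum.inr (Sum.inr y)) (fun z => Sum.inr (Sum.inr (Sum.inl z)))).and <|
      hR.rename (Sum.elim (fun x => Sum.inl (Sum.inl x)) fun y => Sum.inr (Sum.inr y))
        (Sum.elim (fun x => Sum.inl (Sum.inl x)) fun y => Sum.inr (Sum.inr (Sum.inl y))))
    (((Definable.eq_zero (Sum.inr (Sum.inl (Sum.inr 0)))).and
      (Definable.finite_all fun j => Definable.eqN (Sum.inr (Sum.inr j)) (Sum.inl (Sum.inl (q j))))).or
      ((Definable.eq_last (Sum.inr (Sum.inl (Sum.inr 0)))).and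
      (Definable.finite_all fun j => Definable.eq_zero (Sum.inr (Sum.inr j)))))
    Sum.inr (fun z => Sum.inr (Sum.inl z)) (fun j => Sum.inr (Sum.inr j))
  refine (Definable.exists_block (X := X) (P := P) (Y := Y) (Z := (Z ⊕ Fin 1) ⊕ Fin 2)
    (R := fun i α β y z => (z (.inl (.inr 0)) = 0 ∧ z (.inr 1) = Fin.last _ ∧ z (.inr 0) = Fin.last _) ∧
      LRecX (quotEdge (Relation.EqvGen.setoid (Req i)) (RE i α β))
        (quotLabel (Relation.EqvGen.setoid (Req i))
          fun a => {j | ∃ n, num n = j ∧ RC i β a n})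
        (num fun j => z (.inr j)) (Quotient.mk _ (y, fun j => z (.inl j))))
    (((Definable.eq_zero (Sum.inr (Sum.inl (Sum.inr 0)))).and <|
      (Definable.eq_last (Sum.inr (Sum.inr 1))).and
      (Definable.eq_last (Sum.inr (Sum.inr 0)))).and key)).congr fun i α β => ?_
  have hne : (Fin.last _ : Num (A i)) ≠ 0 := fun h =>
    (last_pos (A i)).ne' (congrArg Fin.val h)
  let D' : Block (A i) Y (Z ⊕ Fin 1) → Option (T i) → Prop := fun x b =>
    b.elim (x.2 (.inr 0) = 0) fun a => x.2 (.inr 0) = Fin.last _ ∧ D i (pr i x) a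
  have hD'some : ∀ x a, D' x (some a) ↔ x.2 (.inr 0) = Fin.last _ ∧ D i (pr i x) a :=
    fun _ _ => Iff.rfl
  have hD'none : ∀ x, D' x none ↔ x.2 (.inr 0) = 0 := fun _ => Iff.rfl
  have surj : ∀ b, ∃ x, D' x b := by
    rintro (_ | a)
    · exact ⟨(fun _ => Classical.arbitrary _, fun _ => 0), rfl⟩
    · obtain ⟨x, hx⟩ := hD.surj i a
      exact ⟨(x.1, Sum.elim x.2 fun _ => Fin.last _), rfl, hx⟩
  have uniq : ∀ {x a b}, D' x a → D' x b → a = b := by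
    rintro x (_ | a) (_ | b) ha hb
    · rfl
    · exact absurd (hb.1.symm.trans ha) hne
    · exact absurd (ha.1.symm.trans hb) hne
    · exact congrArg some (hD.unique ha.2 hb.2)
  have main : ∀ {l x}, 2 ≤ l → x.2 (.inr 0) = 0 →
      (LRecX (quotEdge (Relation.EqvGen.setoid (Req i)) (RE i α β))
        (quotLabel (Relation.EqvGen.setoid (Req i))
          fun a => {j | ∃ n, num n = j ∧ RC i β a n}) l (Quotient.mk _ x) ↔
      Nat.card {a // ∃ x, D i x a ∧ R i α β x} = num fun j => β (q j)) := by
    intro l x hl hx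
    rw [← lRecX_star _ _ hl]
    refine lRecX_decode (D := D') surj uniq ?_ ?_ ?_ ?_ _ hx
    · intro x y b hxb
      constructor
      · intro h
        refine (eqvGen_decode (D := D') ?_ h b).1 hxb
        rintro x y (⟨hx, hy⟩ | ⟨⟨hx, hy⟩, a, ha, hb⟩) c
        · have hx : D' x none := hx
          have hy : D' y none := hy
          exact ⟨fun h => uniq h hx ▸ hy, fun h => uniq h hy ▸ hx⟩
        · have hx : D' x (some a) := ⟨hx, ha⟩
          have hy : D' y (some a) := ⟨hy, hb⟩
          exact ⟨fun h => uniq h hx ▸ hy, fun h => uniq h hy ▸ hx⟩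
      · intro hyb
        refine .rel _ _ ?_
        cases b with
        | none => exact .inl ⟨hxb, hyb⟩
        | some a => exact .inr ⟨⟨hxb.1, hyb.1⟩, a, hxb.2, hyb.2⟩
    · rintro x y ⟨hx, hy, ⟨a, ha⟩, h⟩
      exact ⟨none, some a, hx, ⟨hy, ha⟩, a, rfl, rfl, _, ha, h⟩
    · rintro _ _ ⟨a, rfl, rfl, x, hx, h⟩
      obtain ⟨r, hr⟩ := surj none
      exact ⟨r, (x.1, Sum.elim x.2 fun _ => Fin.last _), hr, ⟨rfl, hx⟩, hr, rfl, ⟨a, hx⟩, h⟩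
    · rintro (_ | a) n
      · constructor
        · intro h
          obtain ⟨r, hr⟩ := surj none
          exact ⟨r, hr, fun j => β (q j), h.symm, .inl ⟨hr, fun _ => rfl⟩⟩
        · rintro ⟨r, hr, n, rfl, ⟨-, h⟩ | ⟨h, -⟩⟩
          · exact congrArg num (funext h)
          · exact absurd (h.symm.trans hr) hne
      · constructor
        · intro h
          obtain ⟨x, hx⟩ := surj (some a)
          refine ⟨x, hx, fun _ => 0, ?_, .inr ⟨hx.1, fun _ => rfl⟩⟩
          rw [show n = 0 from h]
          simp [num]
        · rintro ⟨r, hr, n, rfl, ⟨h, -⟩ | ⟨-, h⟩⟩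
          · exact absurd (hr.1.symm.trans h) hne
          · show num n = 0
            simp [num, h]
  -- Two digits are used because a single digit only reaches `1` when `|A| = 1`.
  have hnum : ∀ n : Fin 2 → Num (A i), n 1 = Fin.last _ → n 0 = Fin.last _ → 2 ≤ num n := by
    intro n h₁ h₂
    have := last_pos (A i)
    simp only [num, Fin.sum_univ_two, h₁, h₂]
    simp only [Fin.val_last, Fin.val_zero, Fin.val_one, pow_zero, pow_one, mul_one] at this ⊢
    nlinarith
  constructor
  · rintro ⟨y, z, ⟨h₀, h₁, h₂⟩, h⟩
    exact (main (hnum _ h₁ h₂) h₀).1 h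
  · intro h
    exact ⟨fun _ => Classical.arbitrary _, Sum.elim (fun _ => 0) fun _ => Fin.last _,
      ⟨rfl, rfl, rfl⟩, (main (hnum _ rfl rfl) rfl).2 h⟩

end IsCoding

end LREC

/-! ### Codes for the elements and numbers of `Θ[A]` -/

namespace LREC

section Extend

variable {B X Y P Z J K : Type*}

/-- Juxtaposition of two families of tuples. -/
def extS (a : X × J → B) (b : Y × J → B) (x : (X ⊕ Y) × J) : B :=
  Sum.elim (fun y => a (y, x.2)) (fun y => b (y, x.2)) x.1

/-- Juxtaposition of the number parts of two codes. -/
def extN (a : (X × J) ⊕ (P × K) → B) (b : (Y × J) ⊕ (Z × K) → B) :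
    ((X ⊕ Y) × J) ⊕ ((P ⊕ Z) × K) → B :=
  Sum.elim (extS (fun x => a (.inl x)) fun x => b (.inl x))
    (extS (fun x => a (.inr x)) fun x => b (.inr x))

theorem comp_extS {B' : Type*} (f : B → B') (a : X × J → B) (b : Y × J → B) :
    (fun x => f (extS a b x)) = extS (fun x => f (a x)) fun x => f (b x) := by
  funext ⟨x, j⟩
  cases x <;> rfl

theorem comp_extN {B' : Type*} (f : B → B') (a : (X × J) ⊕ (P × K) → B) (b : (Y × J) ⊕ (Z × K) → B) :
    (fun x => f (extN a b x)) = extN (fun x => f (a x)) fun x => f (b x) := by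
  funext x
  rcases x with ⟨x | x, j⟩ | ⟨x | x, j⟩ <;> rfl

end Extend

variable {τ₁ : FirstOrder.Language.{u, v}} {τ₂ : FirstOrder.Language.{u', v'}} {s t : ℕ}
  (Θ : Transduction τ₁ τ₂ s t)

namespace Transduction

section Single

variable (A : Type w) [τ₁.Structure A]

/-- This bound is what lets `s + t + 1` digits represent every number of `Θ[A]`. Using only `s + t`
digits could fail: for `s = 0` the number `|Θ[A]|` may equal `(|A| + 1) ^ t`, just beyond `t`
digits. -/
theorem card_carrier_lt [Finite A] [Nonempty A] :
    Nat.card (Θ.carrier A) + 1 ≤ (Nat.card A + 1) ^ (s + t + 1) := by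
  have h₁ : Nat.card (Θ.carrier A) ≤ Nat.card (Tup A s t) :=
    (Nat.card_le_card_of_injective _ Subtype.val_injective).trans
      (Nat.card_le_card_of_surjective _ Quotient.mk_surjective)
  have h₂ : Nat.card (Tup A s t) = Nat.card A ^ s * (Nat.card A + 1) ^ t := by
    simp [Nat.card_prod, Nat.card_fun]
  have h₃ : Nat.card A ^ s * (Nat.card A + 1) ^ t ≤ (Nat.card A + 1) ^ (s + t) := by
    rw [pow_add]
    exact Nat.mul_le_mul_right _ (Nat.pow_le_pow_left (Nat.le_succ _) _)
  have h₄ : 0 < (Nat.card A + 1) ^ (s + t) := by positivity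
  have h₅ := Nat.card_pos (α := A)
  rw [pow_succ]
  nlinarith

/-- A code for a block of values from `Θ[A]`: elements are coded by representatives, and numbers by
`s + t + 1` digits. -/
abbrev Code (s t : ℕ) (A : Type w) (X P : Type) : Type w :=
  Block A (X × Fin s) ((X × Fin t) ⊕ (P × Fin (s + t + 1)))

/-- The code `x` denotes the block `a` of values from `Θ[A]`. -/
def Denotes {X P : Type} (x : Code s t A X P) (a : Block (Θ.carrier A) X P) : Prop :=
  (∀ y, Θ.cls A (fun j => x.1 (y, j), fun j => x.2 (.inl (y, j))) = a.1 y) ∧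
    ∀ p, num (fun j => x.2 (.inr (p, j))) = a.2 p

variable {A}

theorem Denotes.ext {X P Y Z : Type} {α : X × Fin s → A} {β} {x : Code s t A Y Z} {α' β' a}
    (h : Θ.Denotes A (X := X) (P := P) (α, β) (α', β')) (hx : Θ.Denotes A x a) :
    Θ.Denotes A (extS α x.1, extN β x.2) (Sum.elim α' a.1, Sum.elim β' a.2) := by
  refine ⟨?_, ?_⟩
  · rintro (y | y)
    exacts [h.1 y, hx.1 y]
  · rintro (y | y)
    exacts [h.2 y, hx.2 y]

theorem exists_denotes [Finite A] [Nonempty A] {X P : Type} (a : Block (Θ.carrier A) X P) :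
    ∃ x, Θ.Denotes A x a := by
  have h₁ : ∀ y, ∃ z, Θ.cls A z = a.1 y := fun y => by
    obtain ⟨z, -, hz⟩ := (a.1 y).2
    exact ⟨z, hz⟩
  have h₂ : ∀ p, ∃ n : Fin (s + t + 1) → Num A, num n = a.2 p := fun p =>
    exists_num_eq ((a.2 p).2.trans_le (Θ.card_carrier_lt A))
  choose f hf using h₁
  choose g hg using h₂
  exact ⟨(fun y => (f y.1).1 y.2, Sum.elim (fun y => (f y.1).2 y.2) fun p => g p.1 p.2), hf, hg⟩

theorem Denotes.unique {X P : Type} {x : Code s t A X P} {a b} (ha : Θ.Denotes A x a)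
    (hb : Θ.Denotes A x b) : a = b :=
  Prod.ext (funext fun y => Subtype.ext ((ha.1 y).symm.trans (hb.1 y)))
    (funext fun p => Fin.ext ((ha.2 p).symm.trans (hb.2 p)))

/-- Each digit in base `|Θ[A]| + 1` costs at most `s + t + 1` digits in base `|A| + 1`. The
additional digit keeps the tuple non-empty even for `m = 0`. -/
theorem exists_digits [Finite A] [Nonempty A] {m : ℕ} (v : Fin m → Num (Θ.carrier A)) :
    ∃ q : Fin ((s + t + 1) * m + 1) → Num A, num q = num v := by
  refine exists_num_eq ((num_lt v).trans_le ?_)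
  calc (Nat.card (Θ.carrier A) + 1) ^ m ≤ ((Nat.card A + 1) ^ (s + t + 1)) ^ m :=
        Nat.pow_le_pow_left (Θ.card_carrier_lt A) _
    _ = (Nat.card A + 1) ^ ((s + t + 1) * m) := (pow_mul _ _ _).symm
    _ ≤ _ := Nat.pow_le_pow_right (Nat.succ_pos _) (Nat.le_succ _)

/-- Expresses the value of a numeral as a cardinality, which makes it independent of the base and
hence accessible to counting in `A`. -/
theorem card_num_lt {C : Type w} {m : ℕ} (v : Fin m → Num C) :
    Nat.card {a : Fin m → Num C // num a < num v} = num v := by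
  have : Nat.card (Fin (num v)) = num v := Nat.card_fin _
  refine (Nat.card_eq_of_bijective
    (fun a : {a : Fin m → Num C // num a < num v} => (⟨num a.1, a.2⟩ : Fin (num v)))
    ⟨?_, ?_⟩).trans this
  · intro a b h
    exact Subtype.ext (num_injective (congrArg Fin.val h))
  · rintro ⟨l, hl⟩
    obtain ⟨n, rfl⟩ := exists_num_eq (B := C) (k := m) (hl.trans (num_lt v))
    exact ⟨⟨n, hl⟩, rfl⟩

end Single

variable {I : Type*} {A : I → Type w} [∀ i, τ₁.Structure (A i)] [∀ i, Finite (A i)]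
  [∀ i, Nonempty (A i)] {X P : Type}

theorem definable_approx (y y' : Fin s → X) (z z' : Fin t → P) :
    Definable τ₁ A fun i α β => Θ.approx (A i) (fun j => α (y j), fun j => β (z j))
      (fun j => α (y' j), fun j => β (z' j)) := by
  refine Definable.eqvGen (Req := fun i _ _ a b => Θ.equ.Realize (A i) (Sum.elim a.1 b.1)
    (Sum.elim a.2 b.2)) ?_ y y' z z'
  refine (Definable.realize Θ.equ Sum.inr Sum.inr).congr fun i α β => ?_
  have h₁ : (fun x => α (.inr x)) = Sum.elim (fun y => α (.inr (.inl y))) fun y => α (.inr (.inr y)) := by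
    funext x
    cases x <;> rfl
  have h₂ : (fun x => β (.inr x)) = Sum.elim (fun y => β (.inr (.inl y))) fun y => β (.inr (.inr y)) := by
    funext x
    cases x <;> rfl
  rw [h₁, h₂]

/-- A tuple is a code as soon as its class meets `θ_V`; it need not satisfy `θ_V` itself. -/
theorem isCoding_cls :
    IsCoding τ₁ (A := A) fun i x (c : Θ.carrier (A i)) => Θ.cls (A i) x = c where
  surj i c := by
    obtain ⟨z, -, hz⟩ := c.2
    exact ⟨z, hz⟩
  unique ha hb := Subtype.ext (ha.symm.trans hb)
  ker := by
    refine ((Θ.definable_approx Sum.inl Sum.inr Sum.inl Sum.inr).and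
      (Definable.exists_block (Y := Fin s) (Z := Fin t) (R := fun i α β y z =>
        Θ.univ.Realize (A i) y z ∧ Θ.approx (A i) (y, z) (fun j => α (.inl j), fun j => β (.inl j)))
      ((Definable.realize Θ.univ Sum.inr Sum.inr).and
        (Θ.definable_approx Sum.inr (fun j => Sum.inl (Sum.inl j)) Sum.inr
          (fun j => Sum.inl (Sum.inl j)))))).congr fun i α β => ?_
    constructor
    · rintro ⟨h, y, z, hyz, h'⟩
      exact ⟨⟨Θ.cls (A i) (y, z), (y, z), hyz, rfl⟩, (Quotient.sound h').symm,
        (Quotient.sound ((Θ.approx (A i)).trans' h' h)).symm⟩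
    · rintro ⟨⟨_, z, hz, rfl⟩, h, h'⟩
      exact ⟨Quotient.exact (h.trans h'.symm), z.1, z.2, hz, Quotient.exact h.symm⟩

theorem definable_card_carrier {k : ℕ} (q : Fin (k + 1) → P) :
    Definable τ₁ A fun i (_ : X → A i) β =>
      Nat.card (Θ.carrier (A i)) = num fun j => β (q j) := by
  refine (Θ.isCoding_cls.card (R := fun _ _ _ _ => True) Definable.true q).congr fun i α β => ?_
  rw [Nat.card_congr (Equiv.subtypeUnivEquiv fun c => ?_)]
  obtain ⟨z, -, hz⟩ := c.2
  exact ⟨z, hz, trivial⟩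

theorem isCoding_num : IsCoding τ₁ (A := A) (Y := Empty) (Z := Fin (s + t + 1))
    fun i x (m : Num (Θ.carrier (A i))) => num x.2 = m where
  surj i m := by
    obtain ⟨n, hn⟩ := exists_num_eq (m.2.trans_le (Θ.card_carrier_lt (A i)))
    exact ⟨(nofun, n), hn⟩
  unique ha hb := Fin.ext (ha.symm.trans hb)
  ker := by
    -- Equal digits code the same number provided that number does not exceed `|Θ[A]|`; the tuple
    -- `q` holds `|Θ[A]|`, obtained by counting classes.
    refine ((Definable.num_eq_num Sum.inl Sum.inr).and
      (Definable.existsN (Z := Fin (s + t + 1)) (R := fun i _ β q =>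
        Nat.card (Θ.carrier (A i)) = num q ∧ ¬ num q < num fun j => β (.inl j))
      ((Θ.definable_card_carrier Sum.inr).and
        (Definable.num_lt_num Sum.inr fun j => Sum.inl (Sum.inl j)).not))).congr fun i α β => ?_
    constructor
    · rintro ⟨h, q, hq, hlt⟩
      exact ⟨⟨num fun j => β (.inl j), by omega⟩, rfl, h.symm⟩
    · rintro ⟨m, h, h'⟩
      replace h : num (fun j => β (.inl j)) = m := h
      obtain ⟨q, hq⟩ := exists_num_eq (B := A i) (k := s + t + 1)
        ((Nat.lt_succ_self _).trans_le (Θ.card_carrier_lt (A i)))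
      exact ⟨h.trans h'.symm, q, hq.symm, by have := m.2; omega⟩

theorem isCoding_denotes {Y Z : Type} [Finite Y] [Finite Z] :
    IsCoding τ₁ (A := A) fun i (x : Code s t (A i) Y Z) a => Θ.Denotes (A i) x a where
  surj i a := Θ.exists_denotes a
  unique ha hb := Denotes.unique Θ ha hb
  ker := by
    refine ((Definable.finite_all fun y : Y => Θ.isCoding_cls.same
        (fun j => Sum.inl (y, j)) (fun j => Sum.inr (y, j))
        (fun j => Sum.inl (Sum.inl (y, j))) (fun j => Sum.inr (Sum.inl (y, j)))).and
      (Definable.finite_all fun z : Z => Θ.isCoding_num.same nofun nofun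
        (fun j => Sum.inl (Sum.inr (z, j))) fun j => Sum.inr (Sum.inr (z, j)))).congr fun i α β => ?_
    constructor
    · rintro ⟨h, h'⟩
      choose f hf using h
      choose g hg using h'
      exact ⟨(f, g), ⟨fun y => (hf y).1, fun z => (hg z).1⟩, fun y => (hf y).2, fun z => (hg z).2⟩
    · rintro ⟨a, h, h'⟩
      exact ⟨fun y => ⟨a.1 y, h.1 y, h'.1 y⟩, fun z => ⟨a.2 z, h.2 z, h'.2 z⟩⟩

/-- Conversion of numbers of `Θ[A]` to numbers of `A` is definable. -/
theorem exists_definable_num_eq (m k : ℕ) :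
    ∃ Q : ∀ i, (Fin m × Fin (s + t + 1) → Num (A i)) → (Fin (k + 1) → Num (A i)) → Prop,
      (∀ {X P : Type} (n : Fin m × Fin (s + t + 1) → P) (q : Fin (k + 1) → P),
        Definable τ₁ A fun i (_ : X → A i) β => Q i (fun j => β (n j)) fun j => β (q j)) ∧
      ∀ i n q (v : Fin m → Num (Θ.carrier (A i))), (∀ j, num (fun l => n (j, l)) = v j) →
        (Q i n q ↔ num v = num q) := by
  -- The value of `v` is the number of tuples below it (`card_num_lt`). The order is tested on codes
  -- by comparing components from the most significant one, each component being a numeral over `A`.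
  refine ⟨fun i n q => Nat.card {a // ∃ x : Code s t (A i) Empty (Fin m), Θ.Denotes (A i) x a ∧
    ∃ j, num (fun l => x.2 (.inr (j, l))) < num (fun l => n (j, l)) ∧
      ∀ j' : {j' // j < j'}, num (fun l => x.2 (.inr (j'.1, l))) = num (fun l => n (j'.1, l))} = num q,
    fun n q => ?_, fun i n q v hv => ?_⟩
  · exact Θ.isCoding_denotes.card (R := fun i _ β x =>
      ∃ j, num (fun l => x.2 (.inr (j, l))) < num (fun l => β (n (j, l))) ∧
      ∀ j' : {j' // j < j'}, num (fun l => x.2 (.inr (j'.1, l))) = num (fun l => β (n (j'.1, l))))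
      (Definable.finite_exists fun j =>
        (Definable.num_lt_num (fun l => Sum.inr (Sum.inr (j, l))) fun l => Sum.inl (n (j, l))).and <|
        Definable.finite_all fun j' => Definable.num_eq_num
          (fun l => Sum.inr (Sum.inr (j'.1, l))) fun l => Sum.inl (n (j'.1, l))) q
  · have key : ∀ {x : Code s t (A i) Empty (Fin m)} {a}, Θ.Denotes (A i) x a →
        ((∃ j, num (fun l => x.2 (.inr (j, l))) < num (fun l => n (j, l)) ∧
          ∀ j' : {j' // j < j'}, num (fun l => x.2 (.inr (j'.1, l))) = num (fun l => n (j'.1, l))) ↔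
        num a.2 < num v) := by
      intro x a hx
      rw [num_lt_num_iff]
      simp only [hv, hx.2, Subtype.forall, Fin.lt_def, Fin.ext_iff]
    rw [← card_num_lt v]
    refine Eq.congr_left (Nat.card_eq_of_bijective (fun a => ⟨a.1.2, ?_⟩) ⟨?_, ?_⟩)
    · obtain ⟨x, hx, h⟩ := a.2
      exact (key hx).1 h
    · intro a b h
      exact Subtype.ext (Prod.ext (funext nofun) (congrArg Subtype.val h))
    · rintro ⟨a, ha⟩
      obtain ⟨x, hx⟩ := Θ.exists_denotes (X := Empty) (nofun, a)
      exact ⟨⟨(nofun, a), x, hx, (key hx).2 ha⟩, rfl⟩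

end Transduction

end LREC

/-! ### Translation of formulae over `Θ[A]` to conditions on codes -/

namespace LREC

variable {τ₁ : FirstOrder.Language.{u, v}} {τ₂ : FirstOrder.Language.{u', v'}} {s t : ℕ}

section Translatable

variable {I : Type*} (A : I → Type w) [∀ i, τ₁.Structure (A i)] (Θ : Transduction τ₁ τ₂ s t)

/-- On codes, the relation `Q` on the structures `Θ[A]` is definable in the structures `A`. -/
def Translatable {X P : Type}
    (Q : ∀ i, (X → Θ.carrier (A i)) → (P → Num (Θ.carrier (A i))) → Prop) : Prop :=
  ∃ Q' : ∀ i, (X × Fin s → A i) → ((X × Fin t) ⊕ (P × Fin (s + t + 1)) → Num (A i)) → Prop,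
    Definable τ₁ A Q' ∧ ∀ i α' β' α β, Θ.Denotes (A i) (α', β') (α, β) → (Q' i α' β' ↔ Q i α β)

end Translatable

namespace Translatable

variable {I : Type*} {A : I → Type w} [∀ i, τ₁.Structure (A i)] {Θ : Transduction τ₁ τ₂ s t}
  {X P X' P' : Type}
  {Q Q₁ Q₂ : ∀ i, (X → Θ.carrier (A i)) → (P → Num (Θ.carrier (A i))) → Prop}

theorem congr (h : Translatable A Θ Q₁) (H : ∀ i α β, Q₁ i α β ↔ Q₂ i α β) :
    Translatable A Θ Q₂ := by
  obtain ⟨Q', hQ', h⟩ := h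
  exact ⟨Q', hQ', fun i α' β' α β hd => (h i α' β' α β hd).trans (H i α β)⟩

theorem rename (h : Translatable A Θ Q) (f : X → X') (g : P → P') :
    Translatable A Θ fun i α β => Q i (fun x => α (f x)) fun p => β (g p) := by
  obtain ⟨Q', hQ', h⟩ := h
  exact ⟨_, hQ'.rename (Prod.map f id) (Sum.map (Prod.map f id) (Prod.map g id)),
    fun i α' β' α β hd => h i _ _ _ _ ⟨fun y => hd.1 (f y), fun p => hd.2 (g p)⟩⟩

theorem not (h : Translatable A Θ Q) : Translatable A Θ fun i α β => ¬ Q i α β := by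
  obtain ⟨Q', hQ', h⟩ := h
  exact ⟨_, hQ'.not, fun i α' β' α β hd => not_congr (h i α' β' α β hd)⟩

theorem and (h₁ : Translatable A Θ Q₁) (h₂ : Translatable A Θ Q₂) :
    Translatable A Θ fun i α β => Q₁ i α β ∧ Q₂ i α β := by
  obtain ⟨Q₁', hQ₁', h₁⟩ := h₁
  obtain ⟨Q₂', hQ₂', h₂⟩ := h₂
  exact ⟨_, hQ₁'.and hQ₂', fun i α' β' α β hd =>
    and_congr (h₁ i α' β' α β hd) (h₂ i α' β' α β hd)⟩

theorem imp (h₁ : Translatable A Θ Q₁) (h₂ : Translatable A Θ Q₂) :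
    Translatable A Θ fun i α β => (Q₁ i α β → Q₂ i α β) :=
  (h₁.and h₂.not).not.congr fun _ _ _ => by tauto

theorem or (h₁ : Translatable A Θ Q₁) (h₂ : Translatable A Θ Q₂) :
    Translatable A Θ fun i α β => Q₁ i α β ∨ Q₂ i α β :=
  (h₁.not.imp h₂).congr fun _ _ _ => by tauto

theorem iff (h₁ : Translatable A Θ Q₁) (h₂ : Translatable A Θ Q₂) :
    Translatable A Θ fun i α β => (Q₁ i α β ↔ Q₂ i α β) :=
  ((h₁.imp h₂).and (h₂.imp h₁)).congr fun _ _ _ => by tauto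

theorem eqN (p q : P) :
    Translatable A Θ fun _ (_ : X → _) β => β p = β q := by
  refine ⟨_, Definable.num_eq_num (fun j => Sum.inr (p, j)) (fun j => Sum.inr (q, j)),
    fun i α' β' α β hd => ?_⟩
  change _ ↔ β p = β q
  rw [Fin.ext_iff, ← hd.2, ← hd.2]

theorem leN (p q : P) :
    Translatable A Θ fun _ (_ : X → _) β => β p ≤ β q := by
  refine ⟨_, (Definable.num_lt_num (fun j => Sum.inr (q, j)) (fun j => Sum.inr (p, j))).not,
    fun i α' β' α β hd => ?_⟩
  change _ ↔ β p ≤ β q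
  rw [Fin.le_def, ← hd.2, ← hd.2, not_lt]

variable [∀ i, Finite (A i)] [∀ i, Nonempty (A i)]

/-- The quantifier ranges over codes, guarded by validity because `Q'` is unconstrained on tuples
coding nothing. -/
theorem exists_block {Y Z : Type} [Finite Y] [Finite Z]
    {Q : ∀ i, (X ⊕ Y → Θ.carrier (A i)) → (P ⊕ Z → Num (Θ.carrier (A i))) → Prop}
    (h : Translatable A Θ Q) :
    Translatable A Θ fun i α β => ∃ a : Block (Θ.carrier (A i)) Y Z,
      Q i (Sum.elim α a.1) (Sum.elim β a.2) := by
  obtain ⟨Q', hQ', h⟩ := h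
  refine ⟨_, Definable.exists_block (Y := Y × Fin s) (Z := (Y × Fin t) ⊕ (Z × Fin (s + t + 1)))
    (R := fun i α' β' y z => (∃ a, Θ.Denotes (A i) (X := Y) (P := Z) (y, z) a) ∧
      Q' i (extS α' y) (extN β' z))
    ((Θ.isCoding_denotes.valid Sum.inr Sum.inr).and
      ((hQ'.rename (extS Sum.inl Sum.inr) (extN Sum.inl Sum.inr)).congr fun i α β => ?_)), ?_⟩
  · rw [comp_extS, comp_extN]
  · intro i α' β' α β hd
    constructor
    · rintro ⟨y, z, ⟨a, ha⟩, hQ⟩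
      exact ⟨a, (h i _ _ _ _ (hd.ext Θ ha)).1 hQ⟩
    · rintro ⟨a, hQ⟩
      obtain ⟨x, hx⟩ := Θ.exists_denotes a
      exact ⟨x.1, x.2, ⟨a, hx⟩, (h i _ _ _ _ (hd.ext Θ hx)).2 hQ⟩

theorem eqS (x y : X) :
    Translatable A Θ fun _ α (_ : P → Num _) => α x = α y := by
  refine ⟨_, Θ.definable_approx (fun j => (x, j)) (fun j => (y, j)) (fun j => Sum.inl (x, j))
    (fun j => Sum.inl (y, j)), fun i α' β' α β hd => ?_⟩
  change _ ↔ α x = α y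
  rw [← Subtype.coe_inj, ← hd.1, ← hd.1]
  exact ⟨fun h => Quotient.sound h, fun h => Quotient.exact h⟩

/-- Neither `θ_V` nor `θ_R` is assumed invariant under `≈`, so suitable representatives have to be
quantified afresh. -/
theorem relMap [τ₂.IsRelational] {n : ℕ} (R : τ₂.Relations n) (x : Fin n → X) :
    Translatable A Θ fun i α (_ : P → Num (Θ.carrier (A i))) =>
      FirstOrder.Language.Structure.RelMap R fun j => α (x j) := by
  refine ⟨_, Definable.exists_block (Y := Fin n × Fin s) (Z := Fin n × Fin t)
    (R := fun i α' β' y z => (∀ k : Fin n, Θ.univ.Realize (A i) (fun j => y (k, j)) (fun j => z (k, j)) ∧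
      Θ.approx (A i) (fun j => y (k, j), fun j => z (k, j))
        (fun j => α' (x k, j), fun j => β' (.inl (x k, j)))) ∧ (Θ.rel R).Realize (A i) y z)
    ((Definable.finite_all fun k => (Definable.realize Θ.univ _ _).and
      (Θ.definable_approx (fun j => Sum.inr (k, j)) (fun j => Sum.inl (x k, j))
        (fun j => Sum.inr (k, j)) (fun j => Sum.inl (Sum.inl (x k, j))))).and
      (Definable.realize (Θ.rel R) _ _)), fun i α' β' α β hd => ?_⟩
  constructor
  · rintro ⟨y, z, h, hR⟩
    exact ⟨fun k => (fun j => y (k, j), fun j => z (k, j)), fun k => (h k).1,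
      fun k => (Quotient.sound (h k).2).trans (hd.1 (x k)), hR⟩
  · rintro ⟨a, h₁, h₂, hR⟩
    exact ⟨fun k => (a k.1).1 k.2, fun k => (a k.1).2 k.2,
      fun k => ⟨h₁ k, Quotient.exact ((h₂ k).trans (hd.1 (x k)).symm)⟩, hR⟩

/-- The satisfying blocks are counted through their codes by `IsCoding.card`. The result is a
numeral over `A`, while `p` is one over `Θ[A]`, so an auxiliary tuple `q` holds the common value
after base conversion. -/
theorem count {Y Z : Type} [Finite Y] [Finite Z] {k : ℕ}
    {Q : ∀ i, (X ⊕ Y → Θ.carrier (A i)) → (P ⊕ Z → Num (Θ.carrier (A i))) → Prop}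
    (h : Translatable A Θ Q) (p : Fin k → P) :
    Translatable A Θ fun i α β => Nat.card {a : Block (Θ.carrier (A i)) Y Z //
      Q i (Sum.elim α a.1) (Sum.elim β a.2)} = num fun j => β (p j) := by
  obtain ⟨Q', hQ', h⟩ := h
  obtain ⟨NE, hNE, hNE'⟩ := Θ.exists_definable_num_eq (A := A) k ((s + t + 1) * k)
  refine ⟨_, Definable.existsN (Z := Fin ((s + t + 1) * k + 1))
    (R := fun i α' β' q => NE i (fun j => β' (.inr (p j.1, j.2))) q ∧
      Nat.card {a : Block (Θ.carrier (A i)) Y Z // ∃ x, Θ.Denotes (A i) x a ∧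
        Q' i (extS α' x.1) (extN β' x.2)} = num q)
    ((hNE (fun j => Sum.inl (Sum.inr (p j.1, j.2))) Sum.inr).and
      (Θ.isCoding_denotes.card (R := fun i α β x => Q' i (extS α x.1)
        (extN (fun p => β (.inl p)) x.2))
      ((hQ'.rename (extS Sum.inl Sum.inr) (extN (fun j => Sum.inl (Sum.inl j)) Sum.inr)).congr
        fun i α β => ?_) Sum.inr)), ?_⟩
  · rw [comp_extS, comp_extN]
  · intro i α' β' α β hd
    have hcard : Nat.card {a : Block (Θ.carrier (A i)) Y Z // ∃ x, Θ.Denotes (A i) x a ∧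
        Q' i (extS α' x.1) (extN β' x.2)} = Nat.card {a : Block (Θ.carrier (A i)) Y Z //
      Q i (Sum.elim α a.1) (Sum.elim β a.2)} := by
      refine Nat.card_congr (Equiv.subtypeEquivRight fun a => ?_)
      constructor
      · rintro ⟨x, hx, hQ⟩
        exact (h i _ _ _ _ (hd.ext Θ hx)).1 hQ
      · intro hQ
        obtain ⟨x, hx⟩ := Θ.exists_denotes a
        exact ⟨x, hx, (h i _ _ _ _ (hd.ext Θ hx)).2 hQ⟩
    have hn : ∀ q, NE i (fun j => β' (.inr (p j.1, j.2))) q ↔ num (fun j => β (p j)) = num q :=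
      fun q => hNE' i _ q (fun j => β (p j)) fun j => hd.2 (p j)
    simp only [hn, hcard]
    constructor
    · rintro ⟨q, h₁, h₂⟩
      exact h₂.trans h₁.symm
    · intro H
      obtain ⟨q, hq⟩ := Θ.exists_digits fun j => β (p j)
      exact ⟨q, hq.symm, H.trans hq.symm⟩

/-- The recursion runs on codes, with labels and the resource converted to base `|A| + 1`;
`lRecX_decode` compares it with the recursion over `Θ[A]`, a code being sent to the class of the
tuple it denotes. -/
theorem lrec {s' t' k m : ℕ}
    {Qeq QE : ∀ i, (X ⊕ (Fin s' ⊕ Fin s') → Θ.carrier (A i)) →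
      (P ⊕ (Fin t' ⊕ Fin t') → Num (Θ.carrier (A i))) → Prop}
    {QC : ∀ i, (X ⊕ Fin s' → Θ.carrier (A i)) →
      (P ⊕ (Fin t' ⊕ Fin (k + 1)) → Num (Θ.carrier (A i))) → Prop}
    (heq : Translatable A Θ Qeq) (hE : Translatable A Θ QE) (hC : Translatable A Θ QC)
    (wS : Fin s' → X) (wN : Fin t' → P) (r : Fin (m + 1) → P) :
    Translatable A Θ fun i α β =>
      let S : Setoid (Tup (Θ.carrier (A i)) s' t') := Relation.EqvGen.setoid fun a b =>
        Qeq i (Sum.elim α (Sum.elim a.1 b.1)) (Sum.elim β (Sum.elim a.2 b.2))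
      LRecX (quotEdge S fun a b =>
          QE i (Sum.elim α (Sum.elim a.1 b.1)) (Sum.elim β (Sum.elim a.2 b.2)))
        (quotLabel S fun a => {j | ∃ n : Fin (k + 1) → Num (Θ.carrier (A i)), num n = j ∧
          QC i (Sum.elim α a.1) (Sum.elim β (Sum.elim a.2 n))})
        (num fun j => β (r j)) (Quotient.mk S (fun j => α (wS j), fun j => β (wN j))) := by
  obtain ⟨Qeq', hQeq', heq⟩ := heq
  obtain ⟨QE', hQE', hE⟩ := hE
  -- The label tuple has no element variables; the `Empty` summand gives it the shape of a block, so
  -- that it can be coded like any other.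
  obtain ⟨QC', hQC', hC⟩ :=
    hC.rename (X' := X ⊕ (Fin s' ⊕ Empty)) (P' := P ⊕ (Fin t' ⊕ Fin (k + 1))) (Sum.map id Sum.inl) id
  obtain ⟨NE, hNE, hNE'⟩ := Θ.exists_definable_num_eq (A := A) (m + 1) ((s + t + 1) * (m + 1))
  obtain ⟨NC, hNC, hNC'⟩ := Θ.exists_definable_num_eq (A := A) (k + 1) ((s + t + 1) * (k + 1))
  let CX := X × Fin s
  let CP := (X × Fin t) ⊕ (P × Fin (s + t + 1))
  let C : I → Type w := fun i => Transduction.Code s t (A i) (Fin s') (Fin t')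
  -- The first alternative identifies all codes of one tuple; the second translates `φ₌`. Both
  -- require valid codes, which keeps the other blocks isolated.
  let Req : ∀ i, (CX → A i) → (CP → Num (A i)) → C i → C i → Prop := fun i α' β' x y =>
    (∃ a, Θ.Denotes (A i) x a ∧ Θ.Denotes (A i) y a) ∨
    (((∃ a, Θ.Denotes (A i) x a) ∧ ∃ a, Θ.Denotes (A i) y a) ∧
      Qeq' i (extS α' (extS x.1 y.1)) (extN β' (extN x.2 y.2)))
  let RE : ∀ i, (CX → A i) → (CP → Num (A i)) → C i → C i → Prop := fun i α' β' x y =>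
    ((∃ a, Θ.Denotes (A i) x a) ∧ ∃ a, Θ.Denotes (A i) y a) ∧
      QE' i (extS α' (extS x.1 y.1)) (extN β' (extN x.2 y.2))
  -- The label condition guesses a code `(y, z)` of the numeral over `Θ[A]` and lets `NC` check that
  -- `q` has the same value.
  let RC : ∀ i, (CX → A i) → (CP → Num (A i)) → C i →
      (Fin ((s + t + 1) * (k + 1) + 1) → Num (A i)) → Prop := fun i α' β' x q =>
    ∃ (y : Empty × Fin s → A i) (z : (Empty × Fin t) ⊕ (Fin (k + 1) × Fin (s + t + 1)) → Num (A i)),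
      (∃ a, Θ.Denotes (A i) (X := Empty) (P := Fin (k + 1)) (y, z) a) ∧
      NC i (fun j => z (.inr j)) q ∧
      QC' i (extS α' (extS x.1 y)) (extN β' (extN x.2 z))
  have key := Definable.lrec (τ := τ₁) (A := A) (X := CX)
    (P := CP ⊕ Fin ((s + t + 1) * (m + 1) + 1)) (Y := Fin s' × Fin s)
    (Z := (Fin s' × Fin t) ⊕ (Fin t' × Fin (s + t + 1)))
    (Req := fun i α β => Req i α fun p => β (.inl p))
    (RE := fun i α β => RE i α fun p => β (.inl p))
    (RC := fun i α β => RC i α fun p => β (.inl p))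
    ((Θ.isCoding_denotes.same (fun y => Sum.inr (Sum.inl y)) (fun y => Sum.inr (Sum.inr y))
      (fun y => Sum.inr (Sum.inl y)) (fun y => Sum.inr (Sum.inr y))).or
      (((Θ.isCoding_denotes.valid (fun y => Sum.inr (Sum.inl y)) (fun y => Sum.inr (Sum.inl y))).and
        (Θ.isCoding_denotes.valid (fun y => Sum.inr (Sum.inr y)) (fun y => Sum.inr (Sum.inr y)))).and
      ((hQeq'.rename (extS Sum.inl (extS (fun y => Sum.inr (Sum.inl y)) fun y => Sum.inr (Sum.inr y)))
        (extN (fun j => Sum.inl (Sum.inl j)) (extN (fun y => Sum.inr (Sum.inl y))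
          fun y => Sum.inr (Sum.inr y)))).congr fun i α β => by
            simp only [comp_extS, comp_extN]
            rfl)))
    (((Θ.isCoding_denotes.valid (fun y => Sum.inr (Sum.inl y)) (fun y => Sum.inr (Sum.inl y))).and
        (Θ.isCoding_denotes.valid (fun y => Sum.inr (Sum.inr y)) (fun y => Sum.inr (Sum.inr y)))).and
      ((hQE'.rename (extS Sum.inl (extS (fun y => Sum.inr (Sum.inl y)) fun y => Sum.inr (Sum.inr y)))
        (extN (fun j => Sum.inl (Sum.inl j)) (extN (fun y => Sum.inr (Sum.inl y))
          fun y => Sum.inr (Sum.inr y)))).congr fun i α β => by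
            simp only [comp_extS, comp_extN]
            rfl))
    (Definable.exists_block ((Θ.isCoding_denotes.valid Sum.inr Sum.inr).and <|
      (hNC (fun j => Sum.inr (Sum.inr j)) (fun j => Sum.inl (Sum.inr (Sum.inr j)))).and <|
      (hQC'.rename (extS (fun j => Sum.inl (Sum.inl j)) (extS (fun y => Sum.inl (Sum.inr y)) Sum.inr))
        (extN (fun j => Sum.inl (Sum.inl (Sum.inl j))) (extN (fun y => Sum.inl (Sum.inr (Sum.inl y)))
          Sum.inr))).congr fun i α β => by
            simp only [comp_extS, comp_extN]
            rfl))
    (fun y => (wS y.1, y.2))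
    (Sum.elim (fun y => Sum.inl (Sum.inl (wS y.1, y.2))) fun y => Sum.inl (Sum.inr (wN y.1, y.2)))
    Sum.inr
  refine ⟨_, Definable.existsN (Z := Fin ((s + t + 1) * (m + 1) + 1))
    (R := fun i α' β' q => NE i (fun j => β' (.inr (r j.1, j.2))) q ∧
      LRecX (quotEdge (Relation.EqvGen.setoid (Req i α' β')) (RE i α' β'))
        (quotLabel (Relation.EqvGen.setoid (Req i α' β'))
          fun a => {j | ∃ n, num n = j ∧ RC i α' β' a n})
        (num q) (Quotient.mk _ (fun y => α' (wS y.1, y.2),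
          Sum.elim (fun y => β' (.inl (wS y.1, y.2))) fun y => β' (.inr (wN y.1, y.2)))))
    ((hNE (fun j => Sum.inl (Sum.inr (r j.1, j.2))) Sum.inr).and (key.congr fun i α β => ?_)), ?_⟩
  · have : (fun j => β (Sum.elim (fun y => Sum.inl (Sum.inl (wS y.1, y.2)))
          (fun y => Sum.inl (Sum.inr (wN y.1, y.2))) j)) =
        Sum.elim (fun y : Fin s' × Fin t => β (.inl (.inl (wS y.1, y.2))))
          fun y : Fin t' × Fin (s + t + 1) => β (.inl (.inr (wN y.1, y.2))) := by
      funext j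
      cases j <;> rfl
    rw [this]
  · intro i α' β' α β hd
    beta_reduce
    extract_lets S
    have hn : ∀ q, NE i (fun j => β' (.inr (r j.1, j.2))) q ↔ num (fun j => β (r j)) = num q :=
      fun q => hNE' i _ q (fun j => β (r j)) fun j => hd.2 (r j)
    have hw : Θ.Denotes (A i) (X := Fin s') (P := Fin t') (fun y => α' (wS y.1, y.2),
        Sum.elim (fun y => β' (.inl (wS y.1, y.2))) fun y => β' (.inr (wN y.1, y.2)))
        (fun j => α (wS j), fun j => β (wN j)) := ⟨fun y => hd.1 (wS y), fun p => hd.2 (wN p)⟩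
    have h₂ : ∀ {x y : C i} {a b}, Θ.Denotes (A i) x a → Θ.Denotes (A i) y b →
        Θ.Denotes (A i) (extS α' (extS x.1 y.1), extN β' (extN x.2 y.2))
          (Sum.elim α (Sum.elim a.1 b.1), Sum.elim β (Sum.elim a.2 b.2)) := fun hx hy =>
      hd.ext Θ (hx.ext Θ hy)
    have hRC : ∀ {x : C i} {a q}, Θ.Denotes (A i) x a → (RC i α' β' x q ↔
        ∃ n : Fin (k + 1) → Num (Θ.carrier (A i)), num n = num q ∧
          QC i (Sum.elim α a.1) (Sum.elim β (Sum.elim a.2 n))) := by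
      intro x a q hx
      have hC' : ∀ {y z b}, Θ.Denotes (A i) (X := Empty) (P := Fin (k + 1)) (y, z) b →
          (QC' i (extS α' (extS x.1 y)) (extN β' (extN x.2 z)) ↔
            QC i (Sum.elim α a.1) (Sum.elim β (Sum.elim a.2 b.2))) := by
        intro y z b hb
        rw [hC i _ _ _ _ (hd.ext Θ (hx.ext Θ hb))]
        have : (fun x => Sum.elim α (Sum.elim a.1 b.1) (Sum.map id Sum.inl x)) = Sum.elim α a.1 := by
          funext x
          cases x <;> rfl
        simp only [id_eq, this]
      constructor
      · rintro ⟨y, z, ⟨b, hb⟩, hN, hQ⟩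
        exact ⟨b.2, (hNC' i _ _ b.2 hb.2).1 hN, (hC' hb).1 hQ⟩
      · rintro ⟨n, hN, hQ⟩
        obtain ⟨y, hy⟩ := Θ.exists_denotes (X := Empty) (nofun, n)
        exact ⟨y.1, y.2, ⟨_, hy⟩, (hNC' i _ _ n hy.2).2 hN, (hC' hy).2 hQ⟩
    have main : ∀ l, LRecX (quotEdge (Relation.EqvGen.setoid (Req i α' β')) (RE i α' β'))
        (quotLabel (Relation.EqvGen.setoid (Req i α' β'))
          fun a => {j | ∃ n, num n = j ∧ RC i α' β' a n})
        l (Quotient.mk _ (fun y => α' (wS y.1, y.2),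
          Sum.elim (fun y => β' (.inl (wS y.1, y.2))) fun y => β' (.inr (wN y.1, y.2)))) ↔
        LRecX (quotEdge S fun a b =>
          QE i (Sum.elim α (Sum.elim a.1 b.1)) (Sum.elim β (Sum.elim a.2 b.2)))
        (quotLabel S fun a => {j | ∃ n : Fin (k + 1) → Num (Θ.carrier (A i)), num n = j ∧
          QC i (Sum.elim α a.1) (Sum.elim β (Sum.elim a.2 n))})
        l (Quotient.mk S (fun j => α (wS j), fun j => β (wN j))) := by
      intro l
      let D : C i → Quotient S → Prop := fun x c => ∃ a, Θ.Denotes (A i) x a ∧ Quotient.mk S a = c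
      have uniq : ∀ {x c d}, D x c → D x d → c = d := by
        rintro x _ _ ⟨a, ha, rfl⟩ ⟨b, hb, rfl⟩
        rw [Transduction.Denotes.unique Θ ha hb]
      refine lRecX_decode (D := D) ?_ uniq ?_ ?_ ?_ ?_ l ⟨_, hw, rfl⟩
      · intro c
        obtain ⟨a, rfl⟩ := Quotient.exists_rep c
        obtain ⟨x, hx⟩ := Θ.exists_denotes a
        exact ⟨x, a, hx, rfl⟩
      · intro x y c hx
        constructor
        · intro h
          refine (eqvGen_decode (D := D) ?_ h c).1 hx
          have step : ∀ {x y a b}, Θ.Denotes (A i) x a → Θ.Denotes (A i) y b →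
              Quotient.mk S a = Quotient.mk S b → ∀ c, D x c ↔ D y c := by
            intro x y a b ha hb hab c
            have hx : D x (Quotient.mk S a) := ⟨a, ha, rfl⟩
            have hy : D y (Quotient.mk S a) := ⟨b, hb, hab.symm⟩
            exact ⟨fun h => uniq hx h ▸ hy, fun h => uniq hy h ▸ hx⟩
          rintro x y (⟨a, hx, hy⟩ | ⟨⟨⟨a, hx⟩, b, hy⟩, hQ⟩)
          · exact step hx hy rfl
          · exact step hx hy (Quotient.sound (.rel _ _ ((heq i _ _ _ _ (h₂ hx hy)).1 hQ)))
        · obtain ⟨a, ha, rfl⟩ := hx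
          rintro ⟨b, hb, hab⟩
          have hab' : Relation.EqvGen _ b a := Quotient.exact hab
          clear hab
          refine Relation.EqvGen.symm _ _ ?_
          -- A derivation of equivalence in `Θ[A]` is lifted to codes. Reflexivity needs the first
          -- alternative of `Req`, as the two codes may differ; transitivity needs a code of the
          -- intermediate tuple.
          induction hab' generalizing x y with
          | rel b a hab => exact .rel _ _ (.inr ⟨⟨⟨b, hb⟩, a, ha⟩, (heq i _ _ _ _ (h₂ hb ha)).2 hab⟩)
          | refl a => exact .rel _ _ (.inl ⟨a, hb, ha⟩)
          | symm a b _ ih => exact .symm _ _ (ih hb ha)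
          | trans a b c _ _ ih₁ ih₂ =>
            obtain ⟨z, hz⟩ := Θ.exists_denotes b
            exact .trans _ _ _ (ih₁ hz hb) (ih₂ ha hz)
      · rintro x y ⟨⟨⟨a, hx⟩, b, hy⟩, hQ⟩
        exact ⟨_, _, ⟨a, hx, rfl⟩, ⟨b, hy, rfl⟩, a, b, rfl, rfl, (hE i _ _ _ _ (h₂ hx hy)).1 hQ⟩
      · rintro _ _ ⟨a, b, rfl, rfl, hQ⟩
        obtain ⟨x, hx⟩ := Θ.exists_denotes a
        obtain ⟨y, hy⟩ := Θ.exists_denotes b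
        exact ⟨x, y, ⟨a, hx, rfl⟩, ⟨b, hy, rfl⟩, ⟨⟨a, hx⟩, b, hy⟩, (hE i _ _ _ _ (h₂ hx hy)).2 hQ⟩
      · intro c j
        constructor
        · rintro ⟨a, rfl, n, rfl, hQ⟩
          obtain ⟨x, hx⟩ := Θ.exists_denotes a
          obtain ⟨q, hq⟩ := Θ.exists_digits n
          exact ⟨x, ⟨a, hx, rfl⟩, q, hq, (hRC hx).2 ⟨n, hq.symm, hQ⟩⟩
        · rintro ⟨x, ⟨a, hx, rfl⟩, q, rfl, hR⟩
          obtain ⟨n, hn, hQ⟩ := (hRC hx).1 hR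
          exact ⟨a, rfl, n, hn, hQ⟩
    simp only [hn]
    constructor
    · rintro ⟨q, hq, h⟩
      rw [hq]
      exact (main _).1 h
    · intro H
      obtain ⟨q, hq⟩ := Θ.exists_digits fun j => β (r j)
      refine ⟨q, hq.symm, (main _).2 ?_⟩
      rwa [hq]

theorem realize [τ₂.IsRelational] (φ : Formula τ₂ X P) :
    Translatable A Θ fun i α β => φ.Realize (Θ.carrier (A i)) α β := by
  have exS : ∀ {X P : Type} {Q : ∀ i, (X ⊕ Fin 1 → Θ.carrier (A i)) →
      (P → Num (Θ.carrier (A i))) → Prop}, Translatable A Θ Q →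
      Translatable A Θ fun i α β => ∃ a, Q i (Sum.elim α fun _ => a) β := by
    intro X P Q h
    refine (exists_block (Z := Empty) (h.rename id Sum.inl)).congr fun i α β => ?_
    constructor
    · rintro ⟨a, ha⟩
      refine ⟨a.1 0, ?_⟩
      rwa [show (fun _ => a.1 0) = a.1 from funext fun j => by rw [Subsingleton.elim j 0]]
    · rintro ⟨a, ha⟩
      exact ⟨(fun _ => a, nofun), ha⟩
  have exN : ∀ {X P : Type} {Q : ∀ i, (X → Θ.carrier (A i)) →
      (P ⊕ Fin 1 → Num (Θ.carrier (A i))) → Prop}, Translatable A Θ Q →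
      Translatable A Θ fun i α β => ∃ a, Q i α (Sum.elim β fun _ => a) := by
    intro X P Q h
    refine (exists_block (Y := Empty) (h.rename Sum.inl id)).congr fun i α β => ?_
    constructor
    · rintro ⟨a, ha⟩
      refine ⟨a.2 0, ?_⟩
      rwa [show (fun _ => a.2 0) = a.2 from funext fun j => by rw [Subsingleton.elim j 0]]
    · rintro ⟨a, ha⟩
      exact ⟨(nofun, fun _ => a), ha⟩
  induction φ with
  | rel R x => exact relMap R x
  | eqS x y => exact eqS x y
  | eqN p q => exact eqN p q
  | leN p q => exact leN p q
  | not φ ih => exact ih.not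
  | and φ ψ ih₁ ih₂ => exact ih₁.and ih₂
  | or φ ψ ih₁ ih₂ => exact ih₁.or ih₂
  | imp φ ψ ih₁ ih₂ => exact ih₁.imp ih₂
  | iff φ ψ ih₁ ih₂ => exact ih₁.iff ih₂
  | allS φ ih => exact (exS ih.not).not.congr fun i α β => not_exists_not
  | exS φ ih => exact exS ih
  | allN φ ih => exact (exN ih.not).not.congr fun i α β => not_exists_not
  | exN φ ih => exact exN ih
  | count s t k ψ p ih => exact ih.count p
  | lrec s t k m φeq φE φC wS wN r ih₁ ih₂ ih₃ => exact ih₁.lrec ih₂ ih₃ wS wN r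

end Translatable

end LREC

/-! ### The translated formula with `s + t` digits per number -/

theorem lemma6p4
    {τ₁ : FirstOrder.Language.{u, v}} {τ₂ : FirstOrder.Language.{u', v'}}
    [τ₁.IsRelational] [τ₂.IsRelational] [Finite τ₁.Symbols] [Finite τ₂.Symbols]
    (s t : ℕ) (hst : 1 ≤ s + t) (Θ : LREC.Transduction τ₁ τ₂ s t)
    (κ lam : ℕ) (φ : LREC.Formula τ₂ (Fin κ) (Fin lam)) :
    ∃ φΘ : LREC.Formula τ₁ (Fin κ × Fin s) ((Fin κ × Fin t) ⊕ (Fin lam × Fin (s + t))),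
      ∀ (A : Type w) [τ₁.Structure A] [Finite A] [Nonempty A], (Θ.dom A).Nonempty →
        ∀ (a : Fin κ → LREC.Tup A s t) (n : Fin lam → Fin (s + t) → LREC.Num A),
          φΘ.Realize A (fun i => (a i.1).1 i.2)
              (Sum.elim (fun i => (a i.1).2 i.2) (fun j => n j.1 j.2)) ↔
            ∃ (ha : ∀ i, Θ.cls A (a i) ∈ Θ.carrier A)
              (hn : ∀ j, LREC.num (n j) < Nat.card (Θ.carrier A) + 1),
              φ.Realize (Θ.carrier A) (fun i => ⟨Θ.cls A (a i), ha i⟩)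
                (fun j => ⟨LREC.num (n j), hn j⟩) := by
  -- Indexing by all finite non-empty structures makes definability over the family yield a single
  -- formula.
  let I := {B : Σ A : Type w, τ₁.Structure A // Finite B.1 ∧ Nonempty B.1}
  let A : I → Type w := fun i => i.1.1
  let (i : I) : τ₁.Structure (A i) := i.1.2
  have (i : I) : Finite (A i) := i.2.1
  have (i : I) : Nonempty (A i) := i.2.2
  obtain ⟨Q, hQ, h⟩ := LREC.Translatable.realize (A := A) (Θ := Θ) φ
  -- The internal codes have one digit more than the numerals of the statement; the most significant
  -- digit is read from an auxiliary variable, which is forced to be `0` below.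
  let g : (Fin κ × Fin t) ⊕ (Fin lam × Fin (s + t + 1)) →
      ((Fin κ × Fin t) ⊕ (Fin lam × Fin (s + t))) ⊕ Fin 1 :=
    Sum.elim (fun y => .inl (.inl y)) fun p =>
      Fin.lastCases (.inr 0) (fun j => .inl (.inr (p.1, j))) p.2
  obtain ⟨φΘ, hφ⟩ := LREC.Definable.existsN (τ := τ₁) (A := A) (X := Fin κ × Fin s)
    (P := (Fin κ × Fin t) ⊕ (Fin lam × Fin (s + t))) (Z := Fin 1)
    (R := fun i α β z => z 0 = 0 ∧
      (∃ a, Θ.Denotes (A i) (X := Fin κ) (P := Fin lam) (α, fun p => Sum.elim β z (g p)) a) ∧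
      Q i α fun p => Sum.elim β z (g p))
    -- Validity of the code is added explicitly: it yields the membership and range conditions, and
    -- `Q` is meaningful only under it.
    ((LREC.Definable.eq_zero (Sum.inr 0)).and <|
      ((Θ.isCoding_denotes.valid (X := Fin κ × Fin s) id g).and (hQ.rename id g)).congr
        fun i α β => by
          have : (fun p => Sum.elim (fun p => β (.inl p)) (fun z => β (.inr z)) (g p)) =
              fun p => β (g p) := by
            funext p
            cases g p <;> rfl
          rw [this]
          rfl)
  refine ⟨φΘ, fun A' _ _ _ _ a n => (hφ ⟨⟨A', inferInstance⟩, inferInstance, inferInstance⟩ _ _).trans ?_⟩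
  have hsnoc : ∀ (z : Fin 1 → LREC.Num A') (j : Fin lam), z 0 = 0 →
      LREC.num (fun l => Sum.elim (Sum.elim (fun i => (a i.1).2 i.2) fun j => n j.1 j.2) z
        (g (.inr (j, l)))) = LREC.num (n j) := by
    intro z j hz
    rw [LREC.num_succ]
    simp [g, hz]
  constructor
  · rintro ⟨z, hz, ⟨⟨b, m⟩, hd⟩, hR⟩
    have ha : ∀ i, Θ.cls A' (a i) = b i := hd.1
    have hm : ∀ j, LREC.num (n j) = m j := fun j => (hsnoc z j hz).symm.trans (hd.2 j)
    refine ⟨fun i => ha i ▸ (b i).2, fun j => hm j ▸ (m j).2, ?_⟩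
    have := (h _ _ _ _ _ hd).1 hR
    convert this using 2
    · exact Subtype.ext (ha _)
    · exact Fin.ext (hm _)
  · rintro ⟨ha, hn, hR⟩
    have hd : Θ.Denotes A' (X := Fin κ) (P := Fin lam) (fun i => (a i.1).1 i.2, fun p =>
        Sum.elim (Sum.elim (fun i => (a i.1).2 i.2) fun j => n j.1 j.2) (fun _ : Fin 1 => 0) (g p))
        (fun i => ⟨Θ.cls A' (a i), ha i⟩, fun j => ⟨LREC.num (n j), hn j⟩) :=
      ⟨fun _ => rfl, fun j => hsnoc _ j rfl⟩
    exact ⟨fun _ => 0, rfl, ⟨_, hd⟩, (h ⟨⟨A', inferInstance⟩, inferInstance, inferInstance⟩ _ _ _ _ hd).2 hR⟩
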